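/- Let $\mu$ be a probability measure on $[0,1]$ that has, with respect to Lebesgue measure on $[0,1]$, a density $f_\mu$ which is $C^1$ and strictly positive on $[0,1]$. Let $H:\mathbb{R}\to\mathbb{R}$ be a strictly convex $C^2$ function whose derivative $H'$ is Lipschitz and satisfies $\epsilon<H'(x)<K$ for all $x\in\mathbb{R}$, for some constants $\epsilon,K>0$. For a probability measure $\nu$ on $\mathbb{R}$ let $F_\nu$ be its cumulative distribution function and $F_\nu^{-1}(y)=\inf\{x: F_\nu(x)>y\}$, with the convention $F_\mu^{-1}(1)=1$. Put $\phi_\nu(\ell)=F_\nu^{-1}(F_\mu(\ell))$, $\gamma_\nu(s)=F_\mu^{-1}(F_\nu(s))$ and $\Gamma_\nu(s)=\int_0^s\gamma_\nu(t)\,dt$, and let $\overline\Pi_\nu$ be the law of $(L,S)=(L,\phi_\nu(L))$ when $L\sim\mu$ (so that $S\sim\nu$). For a probability measure $\lambda$ on $\mathbb{R}$ with finite first moment put $$\Psi_{\nu,\lambda}=\Gamma_\nu-E_\lambda[\Gamma_\nu],\qquad Y_{\nu,\lambda}=E_{\overline\Pi_\nu}\bigl[H'(LS-\Psi_{\nu,\lambda}(S))\mid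 S\bigr],\qquad \alpha_{\nu,\lambda}=\frac{1}{E_\nu[Y_{\nu,\lambda}]},$$ and let $T_\lambda(\nu)=\alpha_{\nu,\lambda}\,Y_{\nu,\lambda}\cdot\nu$ be the probability measure with density $\alpha_{\nu,\lambda}Y_{\nu,\lambda}$ with respect to $\nu$. For $n\ge 1$ let $\overline\lambda_n$ be the law of $\frac{1}{\sqrt n}\sum_{q=1}^n u_q$ when $(u_1,\dots,u_n)$ is uniformly distributed on $\{-1,+1\}^n$. Then there is exactly one probability measure $\nu$ on $\mathbb{R}$ such that $T_{\mathcal N(0,1)}(\nu)=\mathcal N(0,1)$, and it has a finite second moment. If $(\nu_n)_{n\ge1}$ is any sequence of probability measures on $\mathbb{R}$ with $T_{\overline\lambda_n}(\nu_n)=\overline\lambda_n$ for every $n\ge1$, then every $\nu_n$ has a finite second moment and $W_2(\nu_n,\nu)\to0$ as $n\to\infty$, where $W_2$ is the Wasserstein distance of order $2$. -/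

import Mathlib

open MeasureTheory ProbabilityTheory Filter Topology Set
open scoped ENNReal NNReal

noncomputable section

namespace RiskAverse

/-- The right inverse `F_ν⁻¹(y) = inf {x | F_ν(x) > y}` of the cumulative distribution function of
`ν`, for the levels `y` at which this infimum is a real number. -/
def rightInv (ν : Measure ℝ) (y : ℝ) : ℝ :=
  sInf {x : ℝ | y < cdf ν x}

/-- `φ_ν(ℓ) = F_ν⁻¹(F_μ(ℓ))`. It only enters through its values at `μ`-almost every `ℓ`; these have
`0 < F_μ(ℓ) < 1` when `μ` has no atoms, so the infimum in `rightInv` is then a real number. -/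
def phi (μ ν : Measure ℝ) (l : ℝ) : ℝ :=
  rightInv ν (cdf μ l)

/-- `γ_ν(s) = F_μ⁻¹(F_ν(s))`, for `μ` with support `[0,1]`. At the level `F_ν(s) = 1` no `x`
satisfies `F_μ(x) > 1`; there `F_μ⁻¹(1) = 1`, the right end of the support of `μ`. -/
def gam (μ ν : Measure ℝ) (s : ℝ) : ℝ :=
  if cdf ν s < 1 then rightInv μ (cdf ν s) else 1

/-- `Γ_ν(s) = ∫₀ˢ γ_ν(t) dt`. -/
def Gam (μ ν : Measure ℝ) (s : ℝ) : ℝ :=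
  ∫ t in (0 : ℝ)..s, gam μ ν t

/-- `Ψ_{ν,λ}(s) = Γ_ν(s) - E_λ[Γ_ν]`. -/
def Psi (μ lam ν : Measure ℝ) (s : ℝ) : ℝ :=
  Gam μ ν s - ∫ t, Gam μ ν t ∂lam

/-- `Π_ν`: the law of the pair `(L, φ_ν(L))` when `L` has law `μ`. -/
def jointLaw (μ ν : Measure ℝ) : Measure (ℝ × ℝ) :=
  μ.map fun l => (l, phi μ ν l)

instance (μ ν : Measure ℝ) [IsFiniteMeasure μ] : IsFiniteMeasure (jointLaw μ ν) := by
  unfold jointLaw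
  infer_instance

/-- `Y_{ν,λ}(s) = E_{Π_ν}[H'(L S - Ψ_{ν,λ}(S)) | S = s]`, through the regular conditional
distribution of `L` (first coordinate) given `S` (second coordinate) under `Π_ν`. -/
def Y (μ : Measure ℝ) [IsFiniteMeasure μ] (H : ℝ → ℝ) (lam ν : Measure ℝ) (s : ℝ) : ℝ :=
  ∫ l, deriv H (l * s - Psi μ lam ν s) ∂(condDistrib Prod.fst Prod.snd (jointLaw μ ν) s)

/-- The normalizing constant `α_{ν,λ} = 1 / E_ν[Y_{ν,λ}]`. -/
def alpha (μ : Measure ℝ) [IsFiniteMeasure μ] (H : ℝ → ℝ) (lam ν : Measure ℝ) : ℝ :=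
  1 / ∫ s, Y μ H lam ν s ∂ν

/-- The operator `T_λ(ν) = α_{ν,λ} · Y_{ν,λ} · ν`. -/
def T (μ : Measure ℝ) [IsFiniteMeasure μ] (H : ℝ → ℝ) (lam ν : Measure ℝ) : Measure ℝ :=
  ν.withDensity fun s => ENNReal.ofReal (alpha μ H lam ν * Y μ H lam ν s)

/-- The uniform probability on `{-1, +1}`, as a measure on `ℝ`. -/
def fairSign : Measure ℝ :=
  (2⁻¹ : ℝ≥0∞) • Measure.dirac 1 + (2⁻¹ : ℝ≥0∞) • Measure.dirac (-1)

/-- The law of `S_n = (u₁ + ⋯ + u_n) / √n` when `(u₁, …, u_n)` is uniform on `{-1, +1}ⁿ`. -/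
def lambdaBar (n : ℕ) : Measure ℝ :=
  (Measure.pi fun _ : Fin n => fairSign).map fun u => (∑ i, u i) / √(n : ℝ)

/-- The Wasserstein distance of order `2` on `ℝ`; it takes values in `[0, ∞]`, and is finite when
both measures are probabilities with a finite second moment. -/
def W2 (ν₁ ν₂ : Measure ℝ) : ℝ≥0∞ :=
  (⨅ π ∈ {π : Measure (ℝ × ℝ) | π.map Prod.fst = ν₁ ∧ π.map Prod.snd = ν₂},
    ∫⁻ p, ENNReal.ofReal ((p.1 - p.2) ^ 2) ∂π) ^ (1 / 2 : ℝ)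

end RiskAverse

end

noncomputable section

namespace RiskAverse

section

/-! ### Cumulative distribution functions and quantiles -/

/-! Disintegration turns `T` into a push-forward: T_λ(ν) is the law of φ_ν(L) when L has density α
H'(Ψ*) with respect to μ, where Ψ* is the Legendre conjugate of Ψ_{ν,λ}, attained at φ_ν(l)
(`T_eq_map`, `IsBase.sub_Psi_le_conj`). Thus T_λ(ν) = λ is the Euler–Lagrange equation of a convex
problem: minimise ∫ H(Ψ*) dμ over 1-Lipschitz Ψ with ∫ Ψ dλ = 0.

Stability: testing the optimality of each of two fixed points against the potential of the other,
and adding, bounds ∫ (H'(c₂) - H'(c₁))(c₂ - c₁) dμ, where c₁, c₂ are the conjugates, by 2K times the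
L¹(μ) distance of the quantile maps of λ₁ and λ₂ (`integral_mul_le_of_fixedPoints`). Since H' is
strictly increasing, the conjugates converge in measure when this distance vanishes, and their
subgradients φ_{ν_n} converge almost everywhere along subsequences. A fixed point satisfies ν ≤
(K/ε) λ, so uniform fourth moments pass from λ_n to ν_n and give convergence in L²(μ), which
controls W₂ through the quantile coupling (`tendsto_lintegral_sq_of_fixedPoints`). Constant
sequences give uniqueness.

Existence: the direct method yields a minimiser (Ψ, G) (`exists_minimizer`). Let Q be proportional
to H'(G) μ. First-order optimality makes (Ψ, G) optimal Kantorovich potentials from Q to λ, which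
identifies Ψ up to nothing, its mean being fixed; ν is the image of μ under the transport from Q to
λ (`exists_fixedPoint`). `IsBase` covers both μ and Q.

The central limit theorem and a sub-Gaussian bound on sign sums supply the hypotheses on λ_n. -/

lemma cdf_sub_cdf (ν : Measure ℝ) [IsProbabilityMeasure ν] {x y : ℝ} (hxy : x ≤ y) :
    cdf ν y - cdf ν x = ν.real (Ioc x y) := by
  rw [cdf_eq_real, cdf_eq_real, ← Iic_union_Ioc_eq_Iic hxy,
    measureReal_union (Iic_disjoint_Ioc le_rfl) measurableSet_Ioc, add_sub_cancel_left]

lemma continuous_cdf (ν : Measure ℝ) [IsProbabilityMeasure ν] [NullSingletonClass ν] :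
    Continuous (cdf ν) := by
  rw [continuous_iff_continuousAt]
  intro x
  rw [(monotone_cdf ν).continuousAt_iff_leftLim_eq_rightLim, StieltjesFunction.rightLim_eq]
  have h : (cdf ν).measure {x} = 0 := by rw [measure_cdf]; exact measure_singleton x
  rw [StieltjesFunction.measure_singleton, ENNReal.ofReal_eq_zero] at h
  exact le_antisymm ((monotone_cdf ν).leftLim_le le_rfl) (by linarith)

section Quantile

variable (ν : Measure ℝ) {y : ℝ}

lemma bddBelow_cdf_gt (hy : 0 < y) : BddBelow {x : ℝ | y < cdf ν x} := by
  obtain ⟨a, ha⟩ := ((tendsto_cdf_atBot ν).eventually_lt_const hy).exists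
  refine ⟨a, fun x hx => ?_⟩
  by_contra hlt
  exact absurd (monotone_cdf ν (not_le.1 hlt).le) (not_le.2 (ha.trans hx))

lemma nonempty_cdf_gt (hy : y < 1) : {x : ℝ | y < cdf ν x}.Nonempty :=
  ((tendsto_cdf_atTop ν).eventually_const_lt hy).exists

lemma rightInv_le_of_lt_cdf (hy : 0 < y) {x : ℝ} (h : y < cdf ν x) : rightInv ν y ≤ x :=
  csInf_le (bddBelow_cdf_gt ν hy) h

lemma lt_cdf_of_rightInv_lt (hy : y < 1) {x : ℝ} (h : rightInv ν y < x) : y < cdf ν x := by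
  obtain ⟨z, hz, hzx⟩ := exists_lt_of_csInf_lt (nonempty_cdf_gt ν hy) h
  exact lt_of_lt_of_le hz (monotone_cdf ν hzx.le)

lemma cdf_le_of_lt_rightInv (hy : 0 < y) {x : ℝ} (h : x < rightInv ν y) : cdf ν x ≤ y := by
  by_contra hlt
  exact absurd (rightInv_le_of_lt_cdf ν hy (not_le.1 hlt)) (not_le.2 h)

lemma le_cdf_of_rightInv_le (hy : y < 1) {x : ℝ} (h : rightInv ν y ≤ x) : y ≤ cdf ν x := by
  have hc : ContinuousWithinAt (cdf ν) (Ioi x) x :=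
    ((cdf ν).right_continuous x).mono Ioi_subset_Ici_self
  refine ge_of_tendsto hc ?_
  filter_upwards [self_mem_nhdsWithin] with z hz
  exact (lt_cdf_of_rightInv_lt ν hy (h.trans_lt hz)).le

lemma rightInv_mono {z : ℝ} (hy : 0 < y) (hyz : y ≤ z) (hz : z < 1) :
    rightInv ν y ≤ rightInv ν z :=
  csInf_le_csInf (bddBelow_cdf_gt ν hy) (nonempty_cdf_gt ν hz) fun _ hx => lt_of_le_of_lt hyz hx

end Quantile

/-! ### Reference measures on the unit interval -/

/-- A measure on `ℝ` with the same null sets as Lebesgue measure on `[0, 1]`. -/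
structure IsBase (μ : Measure ℝ) : Prop where
  ac : μ ≪ volume.restrict (Icc (0 : ℝ) 1)
  ac' : volume.restrict (Icc (0 : ℝ) 1) ≪ μ

namespace IsBase

variable {μ : Measure ℝ}

lemma ae_mem (h : IsBase μ) : ∀ᵐ l ∂μ, l ∈ Ioo (0 : ℝ) 1 := by
  refine h.ac.ae_le ?_
  rw [← restrict_Ioo_eq_restrict_Icc]
  exact ae_restrict_mem measurableSet_Ioo

lemma nullSingletonClass (h : IsBase μ) : NullSingletonClass μ := ⟨fun x => h.ac (measure_singleton x)⟩

lemma measure_Ioc_pos (h : IsBase μ) {x y : ℝ} (hx : 0 ≤ x) (hxy : x < y) (hy : y ≤ 1) :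
    0 < μ (Ioc x y) := by
  rw [pos_iff_ne_zero]
  intro h0
  have := h.ac' h0
  have hsub : Ioc x y ⊆ Icc (0 : ℝ) 1 := fun z hz => ⟨hx.trans hz.1.le, hz.2.trans hy⟩
  rw [Measure.restrict_apply measurableSet_Ioc, inter_eq_left.2 hsub, Real.volume_Ioc,
    ENNReal.ofReal_eq_zero] at this
  linarith

lemma lt_of_cdf_lt {x y : ℝ} (hxy : cdf μ x < cdf μ y) : x < y := by
  by_contra hlt
  exact absurd (monotone_cdf μ (not_lt.1 hlt)) (not_le.2 hxy)

variable [IsProbabilityMeasure μ]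

lemma continuous_cdf (h : IsBase μ) : Continuous (cdf μ) :=
  have := h.nullSingletonClass
  RiskAverse.continuous_cdf μ

lemma cdf_zero (h : IsBase μ) : cdf μ 0 = 0 := by
  rw [cdf_eq_real, measureReal_eq_zero_iff, ← compl_mem_ae_iff]
  filter_upwards [h.ae_mem] with l hl
  simpa using hl.1

lemma cdf_one (h : IsBase μ) : cdf μ 1 = 1 := by
  have : μ (Iic 1) = 1 := by
    rw [prob_compl_eq_zero_iff measurableSet_Iic |>.symm, ← mem_ae_iff]
    filter_upwards [h.ae_mem] with l hl using hl.2.le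
  rw [cdf_eq_real, measureReal_def, this, ENNReal.toReal_one]

lemma strictMonoOn_cdf (h : IsBase μ) : StrictMonoOn (cdf μ) (Icc 0 1) := by
  intro x hx y hy hxy
  have h1 := cdf_sub_cdf μ hxy.le
  have h2 : 0 < μ.real (Ioc x y) :=
    ENNReal.toReal_pos (h.measure_Ioc_pos hx.1 hxy hy.2).ne' (measure_ne_top _ _)
  linarith

lemma cdf_pos (h : IsBase μ) {l : ℝ} (hl : 0 < l) : 0 < cdf μ l := by
  have h1 := h.strictMonoOn_cdf (left_mem_Icc.2 zero_le_one)
    (⟨le_min hl.le zero_le_one, min_le_right _ _⟩ : min l 1 ∈ Icc (0 : ℝ) 1)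
    (lt_min hl zero_lt_one)
  rw [h.cdf_zero] at h1
  exact h1.trans_le (monotone_cdf μ (min_le_left _ _))

lemma cdf_lt_one (h : IsBase μ) {l : ℝ} (hl : l < 1) : cdf μ l < 1 := by
  have h1 := h.strictMonoOn_cdf
    (⟨le_max_right _ _, max_le hl.le zero_le_one⟩ : max l 0 ∈ Icc (0 : ℝ) 1)
    (right_mem_Icc.2 zero_le_one) (max_lt hl zero_lt_one)
  rw [h.cdf_one] at h1
  exact (monotone_cdf μ (le_max_left _ _)).trans_lt h1

lemma exists_cdf_eq (h : IsBase μ) {y : ℝ} (hy : y ∈ Icc (0 : ℝ) 1) :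
    ∃ x ∈ Icc (0 : ℝ) 1, cdf μ x = y := by
  have := intermediate_value_Icc zero_le_one h.continuous_cdf.continuousOn
  rw [h.cdf_zero, h.cdf_one] at this
  exact this hy

/-- F_μ(L) is uniform, since F_μ is continuous and strictly increasing on the support. -/
lemma measure_cdf_le (h : IsBase μ) {y : ℝ} (hy : y ∈ Icc (0 : ℝ) 1) :
    μ {l | cdf μ l ≤ y} = ENNReal.ofReal y := by
  obtain ⟨x, hx, rfl⟩ := h.exists_cdf_eq hy
  rw [ofReal_cdf]
  apply measure_congr
  filter_upwards [h.ae_mem] with l hl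
  exact propext (h.strictMonoOn_cdf.le_iff_le (Ioo_subset_Icc_self hl) hx)

lemma measure_cdf_lt (h : IsBase μ) {y : ℝ} (hy : y ∈ Icc (0 : ℝ) 1) :
    μ {l | cdf μ l < y} = ENNReal.ofReal y := by
  have := h.nullSingletonClass
  obtain ⟨x, hx, rfl⟩ := h.exists_cdf_eq hy
  rw [ofReal_cdf, ← measure_congr (Iio_ae_eq_Iic (μ := μ))]
  apply measure_congr
  filter_upwards [h.ae_mem] with l hl
  exact propext (h.strictMonoOn_cdf.lt_iff_lt (Ioo_subset_Icc_self hl) hx)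

lemma cdf_mem (h : IsBase μ) {l : ℝ} (hl : l ∈ Ioo (0 : ℝ) 1) : cdf μ l ∈ Ioo (0 : ℝ) 1 :=
  ⟨h.cdf_pos hl.1, h.cdf_lt_one hl.2⟩

/-! ### The monotone transport `phi` -/

variable (ν : Measure ℝ)

lemma monotoneOn_phi (h : IsBase μ) : MonotoneOn (phi μ ν) (Ioo 0 1) :=
  fun _ hx _ hy hxy => rightInv_mono ν (h.cdf_mem hx).1 (monotone_cdf μ hxy) (h.cdf_mem hy).2

/-- Monotonicity holds only on (0, 1); at other points `sInf` may be taken of an empty or unbounded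
set, whence measurability only almost everywhere. -/
lemma aemeasurable_phi (h : IsBase μ) : AEMeasurable (phi μ ν) μ := by
  have h1 : AEMeasurable (phi μ ν) (volume.restrict (Icc (0 : ℝ) 1)) := by
    rw [← restrict_Ioo_eq_restrict_Icc]
    exact aemeasurable_restrict_of_monotoneOn measurableSet_Ioo (h.monotoneOn_phi ν)
  exact h1.mono_ac h.ac

/-- {φ ≤ x} lies between {F_μ < F_ν(x)} and {F_μ ≤ F_ν(x)} up to null sets, and both have mass
F_ν(x). -/
lemma map_phi [IsProbabilityMeasure ν] (h : IsBase μ) : μ.map (phi μ ν) = ν := by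
  have : IsProbabilityMeasure (μ.map (phi μ ν)) :=
    Measure.isProbabilityMeasure_map (h.aemeasurable_phi ν)
  apply Measure.ext_of_Iic
  intro x
  rw [Measure.map_apply_of_aemeasurable (h.aemeasurable_phi ν) measurableSet_Iic, ← ofReal_cdf ν]
  have hx : cdf ν x ∈ Icc (0 : ℝ) 1 := ⟨cdf_nonneg _ _, cdf_le_one _ _⟩
  apply le_antisymm
  · rw [← h.measure_cdf_le hx]
    apply measure_mono_ae
    filter_upwards [h.ae_mem] with l hl hle
    exact le_cdf_of_rightInv_le ν (h.cdf_mem hl).2 hle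
  · rw [← h.measure_cdf_lt hx]
    apply measure_mono_ae
    filter_upwards [h.ae_mem] with l hl hle
    exact rightInv_le_of_lt_cdf ν (h.cdf_mem hl).1 hle

/-! ### The inverse transport `gam` and its primitive -/

lemma bddBelow_lt_cdf (h : IsBase μ) {y : ℝ} (hy : 0 ≤ y) : 0 ∈ lowerBounds {x | y < cdf μ x} :=
  fun x hx => (lt_of_cdf_lt (h.cdf_zero.symm ▸ hy.trans_lt hx : cdf μ 0 < cdf μ x)).le

lemma one_mem_lt_cdf (h : IsBase μ) {y : ℝ} (hy : y < 1) : (1 : ℝ) ∈ {x | y < cdf μ x} := by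
  simpa [h.cdf_one] using hy

lemma gam_nonneg (h : IsBase μ) (t : ℝ) : 0 ≤ gam μ ν t := by
  unfold gam
  split_ifs with ht
  · exact le_csInf ⟨1, h.one_mem_lt_cdf ht⟩ (h.bddBelow_lt_cdf (cdf_nonneg ν t))
  · exact zero_le_one

lemma gam_le_one (h : IsBase μ) (t : ℝ) : gam μ ν t ≤ 1 := by
  unfold gam
  split_ifs with ht
  · exact csInf_le ⟨0, h.bddBelow_lt_cdf (cdf_nonneg ν t)⟩ (h.one_mem_lt_cdf ht)
  · exact le_rfl

lemma monotone_gam (h : IsBase μ) : Monotone (gam μ ν) := by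
  intro s t hst
  by_cases ht : cdf ν t < 1
  · have hs : cdf ν s < 1 := (monotone_cdf ν hst).trans_lt ht
    rw [gam, gam, if_pos hs, if_pos ht]
    exact csInf_le_csInf ⟨0, h.bddBelow_lt_cdf (cdf_nonneg ν s)⟩ ⟨1, h.one_mem_lt_cdf ht⟩
      fun x hx => (monotone_cdf ν hst).trans_lt hx
  · rw [show gam μ ν t = 1 from if_neg ht]
    exact h.gam_le_one ν s

lemma le_gam_of_phi_lt (h : IsBase μ) {l t : ℝ} (hl : l ∈ Ioo (0 : ℝ) 1) (ht : phi μ ν l < t) :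
    l ≤ gam μ ν t := by
  unfold gam
  split_ifs with h1
  · refine le_csInf ⟨1, h.one_mem_lt_cdf h1⟩ fun x hx => ?_
    exact (lt_of_cdf_lt ((lt_cdf_of_rightInv_lt ν (h.cdf_mem hl).2 ht).trans hx)).le
  · exact hl.2.le

lemma gam_le_of_lt_phi (h : IsBase μ) {l t : ℝ} (hl : l ∈ Ioo (0 : ℝ) 1) (ht : t < phi μ ν l) :
    gam μ ν t ≤ l := by
  have h1 := cdf_le_of_lt_rightInv ν (h.cdf_mem hl).1 ht
  rw [gam, if_pos (h1.trans_lt (h.cdf_mem hl).2)]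
  refine le_of_forall_gt_imp_ge_of_dense fun x hx => ?_
  -- Truncating at 1 stays where F_μ is strictly increasing.
  have h2 : cdf μ l < cdf μ (min x 1) := h.strictMonoOn_cdf (Ioo_subset_Icc_self hl)
    ⟨le_min (hl.1.trans hx).le zero_le_one, min_le_right _ _⟩ (lt_min hx hl.2)
  exact csInf_le ⟨0, h.bddBelow_lt_cdf (cdf_nonneg ν t)⟩
    ((h1.trans_lt h2).trans_le (monotone_cdf μ (min_le_left _ _)))

lemma intervalIntegrable_gam (h : IsBase μ) (a b : ℝ) :
    IntervalIntegrable (gam μ ν) volume a b :=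
  (h.monotone_gam ν).intervalIntegrable

lemma Gam_sub (h : IsBase μ) (s t : ℝ) :
    Gam μ ν t - Gam μ ν s = ∫ x in s..t, gam μ ν x := by
  unfold Gam
  rw [intervalIntegral.integral_interval_sub_left] <;> exact h.intervalIntegrable_gam ν _ _

/-- The integrand `gam` takes values in [0, 1]. This bound is the source of compactness in the
existence proof. -/
lemma lipschitzWith_Gam (h : IsBase μ) : LipschitzWith 1 (Gam μ ν) := by
  apply LipschitzWith.of_dist_le_mul
  intro s t
  rw [Real.dist_eq, h.Gam_sub ν t s, NNReal.coe_one, one_mul, Real.dist_eq, ← Real.norm_eq_abs]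
  have := intervalIntegral.norm_integral_le_of_norm_le_const (a := t) (b := s) (C := 1)
    (f := gam μ ν) (fun x _ => by
      rw [Real.norm_eq_abs, abs_of_nonneg (h.gam_nonneg ν x)]; exact h.gam_le_one ν x)
  simpa using this

/-- Every `l ∈ (0, 1)` is a subgradient of `Gam` at `phi l`. -/
lemma Gam_subgradient (h : IsBase μ) {l : ℝ} (hl : l ∈ Ioo (0 : ℝ) 1) (s : ℝ) :
    Gam μ ν (phi μ ν l) + l * (s - phi μ ν l) ≤ Gam μ ν s := by
  have key := h.Gam_sub ν (phi μ ν l) s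
  suffices l * (s - phi μ ν l) ≤ ∫ x in (phi μ ν l)..s, gam μ ν x by linarith
  have hi := h.intervalIntegrable_gam ν
  rcases le_total (phi μ ν l) s with hs | hs
  · have := intervalIntegral.integral_mono_on_of_le_Ioo hs
      (intervalIntegrable_const (c := l)) (hi _ _)
      fun x hx => h.le_gam_of_phi_lt ν hl hx.1
    simpa [mul_comm] using this
  · have := intervalIntegral.integral_mono_on_of_le_Ioo hs (hi _ _)
      (intervalIntegrable_const (c := l))
      fun x hx => h.gam_le_of_lt_phi ν hl hx.2
    rw [intervalIntegral.integral_symm]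
    simp only [intervalIntegral.integral_const, smul_eq_mul] at this
    linarith

end IsBase

end

section

/-! ### The operator `T` as a push-forward -/

/-- A differentiable function with a continuous strictly increasing derivative taking values
in `[ε, K]`, where `0 < ε`. -/
structure IsRiskFun (H : ℝ → ℝ) (ε K : ℝ) : Prop where
  differentiable : Differentiable ℝ H
  continuous_deriv : Continuous (deriv H)
  strictMono_deriv : StrictMono (deriv H)
  pos : 0 < ε
  le_deriv : ∀ x, ε ≤ deriv H x
  deriv_le : ∀ x, deriv H x ≤ K

/-- The conjugate `l φ_ν(l) - Ψ_{ν,λ}(φ_ν(l))` of `Ψ_{ν,λ}` at `l ∈ (0, 1)`. -/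
def conj (μ lam ν : Measure ℝ) (l : ℝ) : ℝ :=
  l * phi μ ν l - Psi μ lam ν (phi μ ν l)

namespace IsRiskFun

variable {H : ℝ → ℝ} {ε K : ℝ}

lemma deriv_pos (hH : IsRiskFun H ε K) (x : ℝ) : 0 < deriv H x := hH.pos.trans_le (hH.le_deriv x)

lemma le_bound (hH : IsRiskFun H ε K) : ε ≤ K := (hH.le_deriv 0).trans (hH.deriv_le 0)

lemma bound_pos (hH : IsRiskFun H ε K) : 0 < K := hH.pos.trans_le hH.le_bound

lemma abs_deriv_le (hH : IsRiskFun H ε K) (x : ℝ) : |deriv H x| ≤ K := by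
  rw [abs_of_pos (hH.deriv_pos x)]; exact hH.deriv_le x

lemma integrable_deriv_comp {α : Type*} [MeasurableSpace α] {m : Measure α} [IsFiniteMeasure m]
    (hH : IsRiskFun H ε K) {g : α → ℝ} (hg : AEMeasurable g m) :
    Integrable (fun x => deriv H (g x)) m :=
  Integrable.of_bound (hH.continuous_deriv.measurable.comp_aemeasurable hg).aestronglyMeasurable K
    (ae_of_all _ fun x => hH.abs_deriv_le (g x))

lemma integral_deriv_comp_mem {α : Type*} [MeasurableSpace α] {m : Measure α}
    [IsProbabilityMeasure m] (hH : IsRiskFun H ε K) {g : α → ℝ} (hg : AEMeasurable g m) :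
    ∫ x, deriv H (g x) ∂m ∈ Icc ε K := by
  have hi := hH.integrable_deriv_comp hg
  constructor
  · simpa using integral_mono (integrable_const ε) hi fun x => hH.le_deriv (g x)
  · simpa using integral_mono hi (integrable_const K) fun x => hH.deriv_le (g x)

end IsRiskFun

variable {μ : Measure ℝ} [IsProbabilityMeasure μ] {H : ℝ → ℝ} {ε K : ℝ}

lemma IsBase.lipschitzWith_Psi (h : IsBase μ) (lam ν : Measure ℝ) :
    LipschitzWith 1 (Psi μ lam ν) := by
  intro x y
  unfold Psi
  rw [edist_sub_right]
  exact h.lipschitzWith_Gam ν x y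

lemma IsBase.aemeasurable_conj (h : IsBase μ) (lam ν : Measure ℝ) :
    AEMeasurable (conj μ lam ν) μ :=
  (aemeasurable_id.mul (h.aemeasurable_phi ν)).sub
    ((h.lipschitzWith_Psi lam ν).continuous.measurable.comp_aemeasurable (h.aemeasurable_phi ν))

/-- Fenchel–Young inequality, with equality at s = φ_ν(l) by definition of `conj`. -/
lemma IsBase.sub_Psi_le_conj (h : IsBase μ) (lam ν : Measure ℝ) {l : ℝ} (hl : l ∈ Ioo (0 : ℝ) 1)
    (s : ℝ) : l * s - Psi μ lam ν s ≤ conj μ lam ν l := by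
  have := h.Gam_subgradient ν hl s
  unfold conj Psi
  linarith

lemma measurable_Y (h : IsBase μ) (hH : IsRiskFun H ε K) (lam ν : Measure ℝ) :
    Measurable (Y μ H lam ν) := by
  have hc : Continuous fun p : ℝ × ℝ => deriv H (p.2 * p.1 - Psi μ lam ν p.1) := by
    have h1 := hH.continuous_deriv
    have h2 := (h.lipschitzWith_Psi lam ν).continuous
    fun_prop
  exact (hc.stronglyMeasurable.integral_condDistrib (Y := Prod.fst) (X := Prod.snd)
    (μ := jointLaw μ ν)).measurable

lemma lintegral_mul_Y (h : IsBase μ) (hH : IsRiskFun H ε K) (lam ν : Measure ℝ)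
    [IsProbabilityMeasure ν] {g : ℝ → ℝ≥0∞} (hg : Measurable g) :
    ∫⁻ s, g s * ENNReal.ofReal (Y μ H lam ν s) ∂ν
      = ∫⁻ l, g (phi μ ν l) * ENNReal.ofReal (deriv H (conj μ lam ν l)) ∂μ := by
  have hc : Continuous fun p : ℝ × ℝ => deriv H (p.2 * p.1 - Psi μ lam ν p.1) := by
    have h1 := hH.continuous_deriv
    have h2 := (h.lipschitzWith_Psi lam ν).continuous
    fun_prop
  have hφ := h.aemeasurable_phi ν
  have hpair : AEMeasurable (fun l => (l, phi μ ν l)) μ := aemeasurable_id.prodMk hφ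
  have hsnd : (jointLaw μ ν).map Prod.snd = ν := by
    rw [jointLaw, AEMeasurable.map_map_of_aemeasurable measurable_snd.aemeasurable hpair]
    exact h.map_phi ν
  -- Disintegration of the joint law along S: ν composed with the kernel of L given S is the law of
  -- (φ_ν(L), L).
  have hdis := compProd_map_condDistrib (mβ := inferInstance) (X := Prod.snd) (Y := Prod.fst) (μ := jointLaw μ ν)
    measurable_fst.aemeasurable
  have hswap : (jointLaw μ ν).map (fun p : ℝ × ℝ => (p.2, p.1)) = μ.map fun l => (phi μ ν l, l) := by
    rw [jointLaw, AEMeasurable.map_map_of_aemeasurable (by fun_prop) hpair]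
    rfl
  rw [hsnd, hswap] at hdis
  have hmeas : Measurable fun p : ℝ × ℝ =>
      g p.1 * ENNReal.ofReal (deriv H (p.2 * p.1 - Psi μ lam ν p.1)) :=
    (hg.comp measurable_fst).mul hc.measurable.ennreal_ofReal
  have key := Measure.lintegral_compProd (μ := ν)
    (κ := condDistrib Prod.fst Prod.snd (jointLaw μ ν)) hmeas
  rw [hdis, lintegral_map' hmeas.aemeasurable
    (show AEMeasurable (fun l => (phi μ ν l, l)) μ from hφ.prodMk aemeasurable_id)] at key
  refine Eq.trans ?_ key.symm
  refine lintegral_congr fun s => ?_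
  have hs : Continuous fun l : ℝ => deriv H (l * s - Psi μ lam ν s) :=
    hc.comp (by fun_prop : Continuous fun l : ℝ => (s, l))
  dsimp only
  rw [lintegral_const_mul _ hs.measurable.ennreal_ofReal]
  congr 1
  exact ofReal_integral_eq_lintegral_ofReal
    (hH.integrable_deriv_comp (g := fun l => l * s - Psi μ lam ν s) (by fun_prop))
    (ae_of_all _ fun l => (hH.deriv_pos _).le)

lemma Y_nonneg (hH : IsRiskFun H ε K) (lam ν : Measure ℝ) (s : ℝ) : 0 ≤ Y μ H lam ν s :=
  integral_nonneg fun _ => (hH.deriv_pos _).le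

lemma alpha_eq (h : IsBase μ) (hH : IsRiskFun H ε K) (lam ν : Measure ℝ)
    [IsProbabilityMeasure ν] :
    alpha μ H lam ν = (∫ l, deriv H (conj μ lam ν l) ∂μ)⁻¹ := by
  have h1 := lintegral_mul_Y h hH lam ν (g := fun _ => 1) measurable_const
  simp only [one_mul] at h1
  rw [alpha, one_div, integral_eq_lintegral_of_nonneg_ae (ae_of_all _ (Y_nonneg hH lam ν))
    (measurable_Y h hH lam ν).aestronglyMeasurable, h1,
    ← integral_eq_lintegral_of_nonneg_ae (ae_of_all _ fun l => (hH.deriv_pos _).le)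
    (hH.integrable_deriv_comp (h.aemeasurable_conj lam ν)).aestronglyMeasurable]

/-- Tower property: under the joint law, L S - Ψ(S) is `conj` at L, so conditioning on S disappears
when testing against functions of S. -/
lemma T_eq_map (h : IsBase μ) (hH : IsRiskFun H ε K) (lam ν : Measure ℝ)
    [IsProbabilityMeasure ν] :
    T μ H lam ν = (μ.withDensity fun l => ENNReal.ofReal
      (alpha μ H lam ν * deriv H (conj μ lam ν l))).map (phi μ ν) := by
  have hα : 0 ≤ alpha μ H lam ν :=
    one_div_nonneg.2 (integral_nonneg fun s => Y_nonneg hH lam ν s)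
  have hφ := h.aemeasurable_phi ν
  ext A hA
  rw [Measure.map_apply_of_aemeasurable (hφ.mono_ac (withDensity_absolutelyContinuous _ _)) hA,
    T, withDensity_apply _ hA, withDensity_apply', ← lintegral_indicator hA,
    ← lintegral_indicator₀ (hφ.nullMeasurable hA)]
  have key := lintegral_mul_Y h hH lam ν
    (g := A.indicator fun _ => ENNReal.ofReal (alpha μ H lam ν)) (measurable_const.indicator hA)
  convert key using 3 with s l
  · by_cases hs : s ∈ A <;> simp [hs, ENNReal.ofReal_mul hα]
  · by_cases hs : phi μ ν l ∈ A <;> simp [hs, ENNReal.ofReal_mul hα]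

end

section

/-! ### Fixed points of `T` -/

lemma integrable_of_lipschitzWith {m : Measure ℝ} [IsFiniteMeasure m] {g : ℝ → ℝ}
    (hg : LipschitzWith 1 g) (hm : Integrable (fun x : ℝ => x) m) : Integrable g m := by
  refine ((integrable_const |g 0|).add hm.abs).mono' hg.continuous.aestronglyMeasurable
    (ae_of_all _ fun x => ?_)
  have h1 := hg.dist_le_mul x 0
  rw [NNReal.coe_one, one_mul, Real.dist_eq, Real.dist_eq, sub_zero] at h1
  have h2 := abs_sub_abs_le_abs_sub (g x) (g 0)
  simp only [Pi.add_apply, Real.norm_eq_abs]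
  linarith

lemma IsBase.exists_mem_Ioo_of_ae {μ : Measure ℝ} (h : IsBase μ) {p : ℝ → Prop} (hp : ∀ᵐ l ∂μ, p l) {a b : ℝ}
    (ha : 0 ≤ a) (hab : a < b) (hb : b ≤ 1) : ∃ l ∈ Ioo a b, p l := by
  by_contra! hn
  have hz : μ (Ioo a b) = 0 := measure_mono_null (fun l hl => hn l hl) hp
  have := h.nullSingletonClass
  rw [measure_congr Ioo_ae_eq_Ioc] at hz
  exact (h.measure_Ioc_pos ha hab hb).ne' hz

variable {μ : Measure ℝ} [IsProbabilityMeasure μ] {H : ℝ → ℝ} {ε K : ℝ}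

lemma alpha_mem (h : IsBase μ) (hH : IsRiskFun H ε K) (lam ν : Measure ℝ)
    [IsProbabilityMeasure ν] : alpha μ H lam ν ∈ Icc K⁻¹ ε⁻¹ := by
  have := hH.integral_deriv_comp_mem (h.aemeasurable_conj lam ν)
  rw [alpha_eq h hH]
  exact ⟨inv_anti₀ (hH.pos.trans_le this.1) this.2, inv_anti₀ hH.pos this.1⟩

lemma IsBase.integral_Psi (h : IsBase μ) (lam ν : Measure ℝ) [IsProbabilityMeasure lam]
    (hlam : Integrable (fun x : ℝ => x) lam) : ∫ s, Psi μ lam ν s ∂lam = 0 := by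
  unfold Psi
  rw [integral_sub (integrable_of_lipschitzWith (h.lipschitzWith_Gam ν) hlam)
    (integrable_const _)]
  simp

section FixedPoint

variable {lam ν : Measure ℝ} [IsProbabilityMeasure ν]

/-- The density of λ with respect to ν averages α H', which is at least ε/K because α ≥ 1/K and H' ≥
ε. This transfers moments from λ to ν. -/
lemma lintegral_le_of_fixedPoint (h : IsBase μ) (hH : IsRiskFun H ε K) (hT : T μ H lam ν = lam)
    {g : ℝ → ℝ≥0∞} (hg : Measurable g) :
    ∫⁻ s, g s ∂ν ≤ ENNReal.ofReal (K / ε) * ∫⁻ s, g s ∂lam := by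
  have hα := alpha_mem h hH lam ν
  have hφ := h.aemeasurable_phi ν
  have hac : μ.withDensity (fun l => ENNReal.ofReal
      (alpha μ H lam ν * deriv H (conj μ lam ν l))) ≪ μ := withDensity_absolutelyContinuous _ _
  have hd : AEMeasurable (fun l => ENNReal.ofReal
      (alpha μ H lam ν * deriv H (conj μ lam ν l))) μ :=
    ((hH.integrable_deriv_comp (h.aemeasurable_conj lam ν)).aemeasurable.const_mul _).ennreal_ofReal
  conv_rhs => rw [← hT, T_eq_map h hH, lintegral_map' hg.aemeasurable (hφ.mono_ac hac),
    lintegral_withDensity_eq_lintegral_mul₀ hd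
      (show AEMeasurable (fun l => g (phi μ ν l)) μ from hg.comp_aemeasurable hφ)]
  conv_lhs => rw [← h.map_phi ν, lintegral_map' hg.aemeasurable hφ]
  rw [← lintegral_const_mul'' _ (hd.mul (show AEMeasurable (fun l => g (phi μ ν l)) μ from hg.comp_aemeasurable hφ))]
  refine lintegral_mono fun l => ?_
  simp only [Pi.mul_apply, ← mul_assoc]
  refine le_mul_of_one_le_left zero_le ?_
  rw [← ENNReal.ofReal_mul (div_nonneg hH.bound_pos.le hH.pos.le), ← ENNReal.ofReal_one]
  refine ENNReal.ofReal_le_ofReal ?_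
  calc (1 : ℝ) = K / ε * (K⁻¹ * ε) := by
        have := hH.pos.ne'
        have := hH.bound_pos.ne'
        field_simp
    _ ≤ _ := by
        have := hH.pos
        have := hH.bound_pos
        have := hα.1
        have := hH.le_deriv (conj μ lam ν l)
        gcongr
        exact (inv_pos.2 hH.bound_pos).le.trans hα.1

lemma integral_of_fixedPoint (h : IsBase μ) (hH : IsRiskFun H ε K) (hT : T μ H lam ν = lam)
    {g : ℝ → ℝ} (hg : Continuous g) :
    ∫ s, g s ∂lam = alpha μ H lam ν * ∫ l, deriv H (conj μ lam ν l) * g (phi μ ν l) ∂μ := by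
  have hα := alpha_mem h hH lam ν
  have hα0 : 0 ≤ alpha μ H lam ν := (inv_pos.2 hH.bound_pos).le.trans hα.1
  have hφ := h.aemeasurable_phi ν
  have hac : μ.withDensity (fun l => ENNReal.ofReal
      (alpha μ H lam ν * deriv H (conj μ lam ν l))) ≪ μ := withDensity_absolutelyContinuous _ _
  have hd : AEMeasurable (fun l => ENNReal.ofReal
      (alpha μ H lam ν * deriv H (conj μ lam ν l))) μ :=
    ((hH.integrable_deriv_comp (h.aemeasurable_conj lam ν)).aemeasurable.const_mul _).ennreal_ofReal
  conv_lhs => rw [← hT, T_eq_map h hH, integral_map (hφ.mono_ac hac)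
    hg.aestronglyMeasurable, integral_withDensity_eq_integral_toReal_smul₀ hd
    (ae_of_all _ fun _ => ENNReal.ofReal_lt_top)]
  rw [← integral_const_mul]
  refine integral_congr_ae (ae_of_all _ fun l => ?_)
  simp only [smul_eq_mul]
  rw [ENNReal.toReal_ofReal (mul_nonneg hα0 (hH.deriv_pos _).le), mul_assoc]

lemma integrable_of_fixedPoint (h : IsBase μ) (hH : IsRiskFun H ε K) (hT : T μ H lam ν = lam)
    (hlam : Integrable (fun x : ℝ => x) lam) : Integrable (fun x : ℝ => x) ν := by
  refine ⟨measurable_id.aestronglyMeasurable, ?_⟩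
  refine (lintegral_le_of_fixedPoint h hH hT measurable_id.enorm).trans_lt ?_
  exact ENNReal.mul_lt_top ENNReal.ofReal_lt_top hlam.2

lemma IsBase.integrable_comp_phi (h : IsBase μ) (hν : Integrable (fun x : ℝ => x) ν) {g : ℝ → ℝ}
    (hg : LipschitzWith 1 g) : Integrable (fun l => g (phi μ ν l)) μ := by
  have h1 := integrable_of_lipschitzWith hg hν
  rw [← h.map_phi ν] at h1
  exact h1.comp_aemeasurable (h.aemeasurable_phi ν)

lemma IsBase.integrable_mul_phi (h : IsBase μ) (hν : Integrable (fun x : ℝ => x) ν) :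
    Integrable (fun l => l * phi μ ν l) μ := by
  refine (h.integrable_comp_phi hν LipschitzWith.id).bdd_mul (c := 1)
    measurable_id.aestronglyMeasurable ?_
  filter_upwards [h.ae_mem] with l hl
  rw [Real.norm_eq_abs, abs_of_pos hl.1]
  exact hl.2.le

lemma IsBase.integrable_conj (h : IsBase μ) (hν : Integrable (fun x : ℝ => x) ν) :
    Integrable (conj μ lam ν) μ :=
  (h.integrable_mul_phi hν).sub (h.integrable_comp_phi hν (h.lipschitzWith_Psi lam ν))

lemma IsRiskFun.integrable_deriv_mul {α : Type*} [MeasurableSpace α] {m : Measure α}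
    (hH : IsRiskFun H ε K) {g k : α → ℝ} (hg : AEMeasurable g m) (hk : Integrable k m) :
    Integrable (fun x => deriv H (g x) * k x) m :=
  hk.bdd_mul (c := K) (hH.continuous_deriv.measurable.comp_aemeasurable hg).aestronglyMeasurable
    (ae_of_all _ fun x => hH.abs_deriv_le (g x))

/-- First order optimality of the conjugate potential of a fixed point. -/
lemma le_integral_of_fixedPoint [IsProbabilityMeasure lam] (h : IsBase μ) (hH : IsRiskFun H ε K)
    (hT : T μ H lam ν = lam) (hlam : Integrable (fun x : ℝ => x) lam) {Ψ G : ℝ → ℝ}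
    (hΨ : LipschitzWith 1 Ψ) (hG : Integrable G μ)
    (hle : ∀ᵐ l ∂μ, ∀ s, l * s - Ψ s ≤ G l) :
    -((alpha μ H lam ν)⁻¹ * ∫ s, Ψ s ∂lam)
      ≤ ∫ l, deriv H (conj μ lam ν l) * (G l - conj μ lam ν l) ∂μ := by
  have hα := alpha_mem h hH lam ν
  have hα0 : 0 < alpha μ H lam ν := (inv_pos.2 hH.bound_pos).trans_le hα.1
  have hν := integrable_of_fixedPoint h hH hT hlam
  have hP := h.lipschitzWith_Psi lam ν
  have hm := h.aemeasurable_conj lam ν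
  have key := integral_of_fixedPoint h hH hT (hP.continuous.sub hΨ.continuous)
  simp only [Pi.sub_apply] at key
  rw [integral_sub (integrable_of_lipschitzWith hP hlam) (integrable_of_lipschitzWith hΨ hlam),
    h.integral_Psi lam ν hlam, zero_sub] at key
  -- The difference of the potentials is integrated against λ, where `Psi` has mean zero, then
  -- pulled back to μ by the fixed point equation.
  have h2 : -((alpha μ H lam ν)⁻¹ * ∫ s, Ψ s ∂lam) = ∫ l, deriv H (conj μ lam ν l) *
      (Psi μ lam ν (phi μ ν l) - Ψ (phi μ ν l)) ∂μ := by
    rw [← mul_neg, key, ← mul_assoc, inv_mul_cancel₀ hα0.ne', one_mul]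
  rw [h2]
  refine integral_mono_ae
    (hH.integrable_deriv_mul hm ((h.integrable_comp_phi hν hP).sub (h.integrable_comp_phi hν hΨ)))
    (hH.integrable_deriv_mul hm (hG.sub (h.integrable_conj hν))) ?_
  filter_upwards [hle] with l hl
  -- At s = φ_ν(l) the competitor satisfies an inequality where `conj` satisfies an equality.
  have h3 := hl (phi μ ν l)
  refine mul_le_mul_of_nonneg_left ?_ (hH.deriv_pos _).le
  have h4 : conj μ lam ν l = l * phi μ ν l - Psi μ lam ν (phi μ ν l) := rfl
  linarith

end FixedPoint

/-! ### Stability of fixed points -/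

/-- Both measures are images of μ under their quantile maps, which couples them. -/
lemma IsBase.abs_integral_sub_le (h : IsBase μ) (lam₁ lam₂ : Measure ℝ) [IsProbabilityMeasure lam₁]
    [IsProbabilityMeasure lam₂] (h₁ : Integrable (fun x : ℝ => x) lam₁)
    (h₂ : Integrable (fun x : ℝ => x) lam₂) {Ψ : ℝ → ℝ} (hΨ : LipschitzWith 1 Ψ) :
    |∫ s, Ψ s ∂lam₁ - ∫ s, Ψ s ∂lam₂| ≤ ∫ l, |phi μ lam₁ l - phi μ lam₂ l| ∂μ := by
  have e : ∀ (m : Measure ℝ) [IsProbabilityMeasure m],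
      ∫ s, Ψ s ∂m = ∫ l, Ψ (phi μ m l) ∂μ := fun m _ => by
    conv_lhs => rw [← h.map_phi m, integral_map (h.aemeasurable_phi m)
      hΨ.continuous.aestronglyMeasurable]
  rw [e lam₁, e lam₂,
    ← integral_sub (h.integrable_comp_phi h₁ hΨ) (h.integrable_comp_phi h₂ hΨ)]
  refine (abs_integral_le_integral_abs).trans (integral_mono
    ((h.integrable_comp_phi h₁ hΨ).sub (h.integrable_comp_phi h₂ hΨ)).abs
    ((h.integrable_comp_phi h₁ LipschitzWith.id).sub
      (h.integrable_comp_phi h₂ LipschitzWith.id)).abs fun l => ?_)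
  have := hΨ.dist_le_mul (phi μ lam₁ l) (phi μ lam₂ l)
  simpa [Real.dist_eq] using this

lemma IsRiskFun.mul_nonneg (hH : IsRiskFun H ε K) (x y : ℝ) :
    0 ≤ (deriv H y - deriv H x) * (y - x) := by
  rcases le_total x y with hxy | hxy
  · exact _root_.mul_nonneg (sub_nonneg.2 (hH.strictMono_deriv.monotone hxy)) (sub_nonneg.2 hxy)
  · exact mul_nonneg_of_nonpos_of_nonpos
      (sub_nonpos.2 (hH.strictMono_deriv.monotone hxy)) (sub_nonpos.2 hxy)

/-- Each fixed point is tested against the potentials of the other. The mean of Ψ₂ under λ₁ is an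
error term, since it vanishes under λ₂, and symmetrically; each costs a factor α⁻¹ ≤ K. -/
lemma integral_mul_le_of_fixedPoints (h : IsBase μ) (hH : IsRiskFun H ε K)
    {lam₁ ν₁ lam₂ ν₂ : Measure ℝ} [IsProbabilityMeasure lam₁] [IsProbabilityMeasure ν₁]
    [IsProbabilityMeasure lam₂] [IsProbabilityMeasure ν₂]
    (hT₁ : T μ H lam₁ ν₁ = lam₁) (hT₂ : T μ H lam₂ ν₂ = lam₂)
    (h₁ : Integrable (fun x : ℝ => x) lam₁) (h₂ : Integrable (fun x : ℝ => x) lam₂) :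
    ∫ l, (deriv H (conj μ lam₂ ν₂ l) - deriv H (conj μ lam₁ ν₁ l)) *
      (conj μ lam₂ ν₂ l - conj μ lam₁ ν₁ l) ∂μ
      ≤ 2 * K * ∫ l, |phi μ lam₁ l - phi μ lam₂ l| ∂μ := by
  have i₁ := h.integrable_conj (lam := lam₁) (integrable_of_fixedPoint h hH hT₁ h₁)
  have i₂ := h.integrable_conj (lam := lam₂) (integrable_of_fixedPoint h hH hT₂ h₂)
  have mem : ∀ lam ν : Measure ℝ, ∀ᵐ l ∂μ, ∀ s, l * s - Psi μ lam ν s ≤ conj μ lam ν l :=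
    fun lam ν => h.ae_mem.mono fun l hl => h.sub_Psi_le_conj lam ν hl
  have A := le_integral_of_fixedPoint h hH hT₁ h₁ (h.lipschitzWith_Psi lam₂ ν₂) i₂ (mem _ _)
  have B := le_integral_of_fixedPoint h hH hT₂ h₂ (h.lipschitzWith_Psi lam₁ ν₁) i₁ (mem _ _)
  have C := h.abs_integral_sub_le lam₁ lam₂ h₁ h₂ (h.lipschitzWith_Psi lam₂ ν₂)
  have D := h.abs_integral_sub_le lam₁ lam₂ h₁ h₂ (h.lipschitzWith_Psi lam₁ ν₁)
  rw [h.integral_Psi lam₂ ν₂ h₂, sub_zero] at C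
  rw [h.integral_Psi lam₁ ν₁ h₁, zero_sub, abs_neg] at D
  have bound : ∀ (lam ν : Measure ℝ) [IsProbabilityMeasure ν] (x y : ℝ), |x| ≤ y →
      (alpha μ H lam ν)⁻¹ * x ≤ K * y := by
    intro lam ν _ x y hxy
    have hα := alpha_mem h hH lam ν
    have hK := hH.bound_pos
    have hα0 : 0 < alpha μ H lam ν := (inv_pos.2 hK).trans_le hα.1
    calc (alpha μ H lam ν)⁻¹ * x ≤ (alpha μ H lam ν)⁻¹ * y := by
          gcongr
          exact (le_abs_self x).trans hxy
      _ ≤ K * y := by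
          refine mul_le_mul_of_nonneg_right ?_ ((abs_nonneg x).trans hxy)
          exact inv_le_of_inv_le₀ hK hα.1
  have C' := bound lam₁ ν₁ _ _ C
  have D' := bound lam₂ ν₂ _ _ D
  have e : ∀ l, (deriv H (conj μ lam₂ ν₂ l) - deriv H (conj μ lam₁ ν₁ l)) *
      (conj μ lam₂ ν₂ l - conj μ lam₁ ν₁ l)
      = -(deriv H (conj μ lam₂ ν₂ l) * (conj μ lam₁ ν₁ l - conj μ lam₂ ν₂ l))
        - deriv H (conj μ lam₁ ν₁ l) * (conj μ lam₂ ν₂ l - conj μ lam₁ ν₁ l) := fun l => by ring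
  simp_rw [e]
  have j₁ : Integrable (fun l => -(deriv H (conj μ lam₂ ν₂ l) *
      (conj μ lam₁ ν₁ l - conj μ lam₂ ν₂ l))) μ :=
    (hH.integrable_deriv_mul (h.aemeasurable_conj _ _) (i₁.sub i₂)).neg
  have j₂ : Integrable (fun l => deriv H (conj μ lam₁ ν₁ l) *
      (conj μ lam₂ ν₂ l - conj μ lam₁ ν₁ l)) μ :=
    hH.integrable_deriv_mul (h.aemeasurable_conj _ _) (i₂.sub i₁)
  rw [integral_sub j₁ j₂, integral_neg]
  linarith

/-- Outside the δ-ball around x the product is at least δ times the smaller increment of H' over [x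
- δ, x] and [x, x + δ], which is positive. -/
lemma IsRiskFun.tendsto_of_mul_tendsto_zero {ι : Type*} {F : Filter ι} (hH : IsRiskFun H ε K)
    {u : ι → ℝ} {x : ℝ}
    (hu : Tendsto (fun i => (deriv H (u i) - deriv H x) * (u i - x)) F (𝓝 0)) :
    Tendsto u F (𝓝 x) := by
  rw [Metric.tendsto_nhds]
  intro δ hδ
  have h1 := hH.strictMono_deriv (lt_add_of_pos_right x hδ)
  have h2 := hH.strictMono_deriv (sub_lt_self x hδ)
  have hc : 0 < min (deriv H (x + δ) - deriv H x) (deriv H x - deriv H (x - δ)) * δ :=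
    mul_pos (lt_min (sub_pos.2 h1) (sub_pos.2 h2)) hδ
  filter_upwards [hu.eventually_lt_const hc] with i hi
  by_contra hlt
  refine absurd hi (not_lt.2 ?_)
  rw [Real.dist_eq, not_lt, le_abs] at hlt
  rcases hlt with hlt | hlt
  · refine mul_le_mul ((min_le_left _ _).trans ?_) hlt hδ.le ?_
    · have := hH.strictMono_deriv.monotone (show x + δ ≤ u i by linarith)
      linarith
    · exact sub_nonneg.2 (hH.strictMono_deriv.monotone (by linarith))
  · rw [← neg_mul_neg (deriv H (u i) - deriv H x)]
    refine mul_le_mul ((min_le_right _ _).trans ?_) hlt hδ.le ?_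
    · have := hH.strictMono_deriv.monotone (show u i ≤ x - δ by linarith)
      linarith
    · have := hH.strictMono_deriv.monotone (show u i ≤ x by linarith)
      linarith

/-- φ_ν(l) attains the conjugate at l, hence is a subgradient of it there. -/
lemma IsBase.conj_subgradient (h : IsBase μ) (lam ν : Measure ℝ) {l l' : ℝ}
    (hl' : l' ∈ Ioo (0 : ℝ) 1) :
    conj μ lam ν l + (l' - l) * phi μ ν l ≤ conj μ lam ν l' := by
  have := h.sub_Psi_le_conj lam ν hl' (phi μ ν l)
  have h4 : conj μ lam ν l = l * phi μ ν l - Psi μ lam ν (phi μ ν l) := rfl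
  linarith

lemma IsBase.ae_continuousAt_phi (h : IsBase μ) (ν : Measure ℝ) :
    ∀ᵐ l ∂μ, ContinuousAt (phi μ ν) l := by
  have := h.nullSingletonClass
  have hc := (h.monotoneOn_phi ν).countable_not_continuousWithinAt
  have h1 : ∀ᵐ l ∂μ, l ∉ {x ∈ Ioo (0 : ℝ) 1 | ¬ ContinuousWithinAt (phi μ ν) (Ioo 0 1) x} :=
    measure_eq_zero_iff_ae_notMem.1 (hc.measure_zero μ)
  filter_upwards [h1, h.ae_mem] with l hl hm
  have h2 : ContinuousWithinAt (phi μ ν) (Ioo 0 1) l := by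
    by_contra hn
    exact hl ⟨hm, hn⟩
  exact h2.continuousAt (Ioo_mem_nhds hm.1 hm.2)

/-- Convex functions: convergence of values forces convergence of subgradients wherever the limiting
subgradient is continuous. Chord slopes of the conjugates separate φ at their two ends. -/
lemma IsBase.tendsto_phi_of_tendsto_conj (h : IsBase μ) {lams νs : ℕ → Measure ℝ}
    {lam ν : Measure ℝ}
    (hc : ∀ᵐ l ∂μ, Tendsto (fun n => conj μ (lams n) (νs n) l) atTop (𝓝 (conj μ lam ν l))) :
    ∀ᵐ l ∂μ, Tendsto (fun n => phi μ (νs n) l) atTop (𝓝 (phi μ ν l)) := by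
  filter_upwards [hc, h.ae_mem, h.ae_continuousAt_phi ν] with l hl hm hcont
  rw [tendsto_order]
  constructor
  · intro x hx
    -- Choose b < l with φ_ν(b) > x and convergence at b. The limiting chord slope on [b, l] exceeds
    -- x, and the n-th slope is at most φ_{ν_n}(l).
    obtain ⟨a, haI, ha⟩ := (mem_nhdsLE_iff_exists_mem_Ico_Ioc_subset hm.1).1
      (mem_nhdsWithin_of_mem_nhds (hcont.eventually_const_lt hx))
    obtain ⟨b, hb, hbt⟩ := h.exists_mem_Ioo_of_ae hc haI.1 haI.2 hm.2.le
    have hbm : b ∈ Ioo (0 : ℝ) 1 := ⟨haI.1.trans_lt hb.1, hb.2.trans hm.2⟩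
    have hbx : x < phi μ ν b := ha ⟨hb.1, hb.2.le⟩
    have hlb : 0 < l - b := sub_pos.2 hb.2
    have hlim := (hl.sub hbt).div_const (l - b)
    have hx' : x < (conj μ lam ν l - conj μ lam ν b) / (l - b) := by
      rw [lt_div_iff₀ hlb]
      have := h.conj_subgradient lam ν (l := b) hm
      nlinarith
    filter_upwards [hlim.eventually_const_lt hx'] with n hn
    refine hn.trans_le ?_
    rw [div_le_iff₀ hlb]
    have := h.conj_subgradient (lams n) (νs n) (l := l) hbm
    nlinarith
  · intro x hx
    obtain ⟨a, haI, ha⟩ := (mem_nhdsGE_iff_exists_mem_Ioc_Ico_subset hm.2).1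
      (mem_nhdsWithin_of_mem_nhds (hcont.eventually_lt_const hx))
    obtain ⟨b, hb, hbt⟩ := h.exists_mem_Ioo_of_ae hc hm.1.le haI.1 haI.2
    have hbm : b ∈ Ioo (0 : ℝ) 1 := ⟨hm.1.trans hb.1, hb.2.trans_le haI.2⟩
    have hbx : phi μ ν b < x := ha ⟨hb.1.le, hb.2⟩
    have hlb : 0 < b - l := sub_pos.2 hb.1
    have hlim := (hbt.sub hl).div_const (b - l)
    have hx' : (conj μ lam ν b - conj μ lam ν l) / (b - l) < x := by
      rw [div_lt_iff₀ hlb]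
      have := h.conj_subgradient lam ν (l := b) hm
      nlinarith
    filter_upwards [hlim.eventually_lt_const hx'] with n hn
    refine lt_of_le_of_lt ?_ hn
    rw [le_div_iff₀ hlb]
    have := h.conj_subgradient (lams n) (νs n) (l := l) hbm
    nlinarith

end

/-! ### Moment bounds, uniform integrability and convergence of fixed points -/

section

/-- Truncation at M: the bounded part converges by domination, and where u > M one has u ≤ u²/M,
which contributes at most C/M. -/
lemma tendsto_lintegral_zero_of_sq_le {α : Type*} [MeasurableSpace α] {m : Measure α}
    [IsFiniteMeasure m] {u : ℕ → α → ℝ≥0∞} (hu : ∀ n, AEMeasurable (u n) m) {C : ℝ≥0∞}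
    (hC : C ≠ ∞) (hb : ∀ n, ∫⁻ x, u n x ^ 2 ∂m ≤ C)
    (hlim : ∀ᵐ x ∂m, Tendsto (fun n => u n x) atTop (𝓝 0)) :
    Tendsto (fun n => ∫⁻ x, u n x ∂m) atTop (𝓝 0) := by
  rw [ENNReal.tendsto_nhds_zero]
  intro δ hδ
  have hδ2 : 0 < δ / 2 := ENNReal.half_pos hδ.ne'
  obtain ⟨M, hM, hMt⟩ : ∃ M : ℝ≥0, 0 < M ∧ C / M ≤ δ / 2 := by
    have h1 : Tendsto (fun N : ℕ => C / (N : ℝ≥0∞)) atTop (𝓝 0) := by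
      simpa [div_eq_mul_inv] using
        ENNReal.Tendsto.const_mul ENNReal.tendsto_inv_nat_nhds_zero (Or.inr hC)
    obtain ⟨N, hN, hN0⟩ := ((ENNReal.tendsto_nhds_zero.1 h1 _ hδ2).and
      (eventually_gt_atTop 0)).exists
    exact ⟨N, by exact_mod_cast hN0, by simpa using hN⟩
  have hM0 : (M : ℝ≥0∞) ≠ 0 := by exact_mod_cast hM.ne'
  have hdom : Tendsto (fun n => ∫⁻ x, min (u n x) M ∂m) atTop (𝓝 (∫⁻ _, 0 ∂m)) := by
    refine tendsto_lintegral_of_dominated_convergence' (fun _ => (M : ℝ≥0∞))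
      (fun n => (hu n).min aemeasurable_const) (fun n => ae_of_all _ fun x => min_le_right _ _)
      ?_ ?_
    · rw [lintegral_const]
      exact ENNReal.mul_ne_top ENNReal.coe_ne_top (measure_ne_top _ _)
    · filter_upwards [hlim] with x hx
      simpa using hx.min (tendsto_const_nhds (x := (M : ℝ≥0∞)))
  rw [lintegral_zero] at hdom
  filter_upwards [ENNReal.tendsto_nhds_zero.1 hdom _ hδ2] with n hn
  calc ∫⁻ x, u n x ∂m ≤ ∫⁻ x, (min (u n x) M + u n x ^ 2 * (M : ℝ≥0∞)⁻¹) ∂m := by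
        refine lintegral_mono fun x => ?_
        rcases le_total (u n x) M with h | h
        · rw [min_eq_left h]; exact le_self_add
        · refine le_trans ?_ le_add_self
          calc u n x = u n x * (M * (M : ℝ≥0∞)⁻¹) := by
                rw [ENNReal.mul_inv_cancel hM0 ENNReal.coe_ne_top, mul_one]
            _ ≤ u n x * (u n x * (M : ℝ≥0∞)⁻¹) := by gcongr
            _ = _ := by ring
    _ = ∫⁻ x, min (u n x) M ∂m + (∫⁻ x, u n x ^ 2 ∂m) * (M : ℝ≥0∞)⁻¹ := by
        rw [lintegral_add_left' ((hu n).min aemeasurable_const),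
          lintegral_mul_const'' _ ((hu n).pow_const 2)]
    _ ≤ δ / 2 + δ / 2 := by
        gcongr
        refine le_trans ?_ hMt
        rw [div_eq_mul_inv]
        gcongr
        exact hb n
    _ = δ := ENNReal.add_halves δ

lemma memLp_two_of_fourth_moment {m : Measure ℝ} [IsFiniteMeasure m]
    (hm : ∫⁻ x, ENNReal.ofReal (x ^ 4) ∂m ≠ ∞) : MemLp id 2 m := by
  have h4 : Integrable (fun x : ℝ => x ^ 4) m := by
    refine ⟨(by fun_prop : Measurable fun x : ℝ => x ^ 4).aestronglyMeasurable, ?_⟩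
    rw [hasFiniteIntegral_iff_ofReal (ae_of_all _ fun x => by positivity)]
    exact hm.lt_top
  rw [memLp_two_iff_integrable_sq measurable_id.aestronglyMeasurable]
  refine ((integrable_const (1 : ℝ)).add h4).mono'
    (measurable_id.pow_const 2).aestronglyMeasurable (ae_of_all _ fun x => ?_)
  simp only [Pi.add_apply, Real.norm_eq_abs, id, abs_of_nonneg (sq_nonneg x)]
  nlinarith [sq_nonneg (x ^ 2 - 1)]

lemma integrable_of_fourth_moment {m : Measure ℝ} [IsFiniteMeasure m]
    (hm : ∫⁻ x, ENNReal.ofReal (x ^ 4) ∂m ≠ ∞) : Integrable (fun x : ℝ => x) m :=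
  (memLp_two_of_fourth_moment hm).integrable one_le_two

variable {μ : Measure ℝ} [IsProbabilityMeasure μ] {H : ℝ → ℝ} {ε K : ℝ}

lemma IsBase.lintegral_comp_phi (h : IsBase μ) (ν : Measure ℝ) [IsProbabilityMeasure ν]
    {g : ℝ → ℝ≥0∞} (hg : Measurable g) : ∫⁻ l, g (phi μ ν l) ∂μ = ∫⁻ s, g s ∂ν := by
  conv_rhs => rw [← h.map_phi ν, lintegral_map' hg.aemeasurable (h.aemeasurable_phi ν)]

section Coupling

variable {νs : ℕ → Measure ℝ} {ν : Measure ℝ} [∀ n, IsProbabilityMeasure (νs n)]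
  [IsProbabilityMeasure ν] {C : ℝ≥0∞}

lemma IsBase.lintegral_phi_sub_fourth_le (h : IsBase μ) (ν₁ ν₂ : Measure ℝ)
    [IsProbabilityMeasure ν₁] [IsProbabilityMeasure ν₂]
    (h₁ : ∫⁻ x, ENNReal.ofReal (x ^ 4) ∂ν₁ ≤ C) (h₂ : ∫⁻ x, ENNReal.ofReal (x ^ 4) ∂ν₂ ≤ C) :
    ∫⁻ l, ENNReal.ofReal ((phi μ ν₁ l - phi μ ν₂ l) ^ 4) ∂μ ≤ 8 * (C + C) := by
  have hm : Measurable fun x : ℝ => ENNReal.ofReal (x ^ 4) := by fun_prop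
  calc ∫⁻ l, ENNReal.ofReal ((phi μ ν₁ l - phi μ ν₂ l) ^ 4) ∂μ
      ≤ ∫⁻ l, 8 * (ENNReal.ofReal (phi μ ν₁ l ^ 4) + ENNReal.ofReal (phi μ ν₂ l ^ 4)) ∂μ := by
        refine lintegral_mono fun l => ?_
        dsimp only
        rw [← ENNReal.ofReal_add (by positivity) (by positivity),
          show (8 : ℝ≥0∞) = ENNReal.ofReal 8 by simp, ← ENNReal.ofReal_mul (by norm_num)]
        refine ENNReal.ofReal_le_ofReal ?_
        generalize phi μ ν₁ l = a
        generalize phi μ ν₂ l = b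
        nlinarith [sq_nonneg (a ^ 2 - b ^ 2), sq_nonneg (a + b), sq_nonneg (a - b),
          sq_nonneg ((a + b) ^ 2), mul_nonneg (sq_nonneg (a + b)) (sq_nonneg (a - b)),
          mul_nonneg (sq_nonneg (a + b)) (sq_nonneg (a + b))]
    _ = 8 * (∫⁻ x, ENNReal.ofReal (x ^ 4) ∂ν₁ + ∫⁻ x, ENNReal.ofReal (x ^ 4) ∂ν₂) := by
        have e : ∀ ν : Measure ℝ, AEMeasurable (fun l => ENNReal.ofReal (phi μ ν l ^ 4)) μ :=
          fun ν => hm.comp_aemeasurable (h.aemeasurable_phi ν)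
        rw [lintegral_const_mul' _ _ (by finiteness), lintegral_add_left' (e ν₁),
          ← h.lintegral_comp_phi ν₁ hm, ← h.lintegral_comp_phi ν₂ hm]
    _ ≤ 8 * (C + C) := by gcongr

lemma IsBase.tendsto_lintegral_sq (h : IsBase μ) (hC : C ≠ ∞)
    (hb : ∀ n, ∫⁻ x, ENNReal.ofReal (x ^ 4) ∂(νs n) ≤ C) (hν : ∫⁻ x, ENNReal.ofReal (x ^ 4) ∂ν ≤ C)
    (hlim : ∀ᵐ l ∂μ, Tendsto (fun n => phi μ (νs n) l) atTop (𝓝 (phi μ ν l))) :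
    Tendsto (fun n => ∫⁻ l, ENNReal.ofReal ((phi μ (νs n) l - phi μ ν l) ^ 2) ∂μ)
      atTop (𝓝 0) := by
  refine tendsto_lintegral_zero_of_sq_le (C := 8 * (C + C))
    (fun n => (((h.aemeasurable_phi _).sub (h.aemeasurable_phi _)).pow_const 2).ennreal_ofReal)
    (by finiteness) (fun n => ?_) ?_
  · refine le_trans (le_of_eq ?_) (h.lintegral_phi_sub_fourth_le (νs n) ν (hb n) hν)
    refine lintegral_congr fun l => ?_
    rw [← ENNReal.ofReal_pow (sq_nonneg _), ← pow_mul]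
  · filter_upwards [hlim] with l hl
    have h1 : Tendsto (fun n => (phi μ (νs n) l - phi μ ν l) ^ 2) atTop (𝓝 0) := by
      simpa using (hl.sub_const (phi μ ν l)).pow 2
    simpa using ENNReal.tendsto_ofReal h1

lemma IsBase.tendsto_integral_abs (h : IsBase μ) (hC : C ≠ ∞)
    (hb : ∀ n, ∫⁻ x, ENNReal.ofReal (x ^ 4) ∂(νs n) ≤ C) (hν : ∫⁻ x, ENNReal.ofReal (x ^ 4) ∂ν ≤ C)
    (hlim : ∀ᵐ l ∂μ, Tendsto (fun n => phi μ (νs n) l) atTop (𝓝 (phi μ ν l))) :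
    Tendsto (fun n => ∫ l, |phi μ ν l - phi μ (νs n) l| ∂μ) atTop (𝓝 0) := by
  have hm : ∀ n, AEMeasurable (fun l => |phi μ ν l - phi μ (νs n) l|) μ :=
    fun n => ((h.aemeasurable_phi _).sub (h.aemeasurable_phi _)).abs
  have key : Tendsto (fun n => ∫⁻ l, ENNReal.ofReal |phi μ ν l - phi μ (νs n) l| ∂μ)
      atTop (𝓝 0) := by
    -- The constant comes from y² ≤ 1 + y⁴ and (a - b)⁴ ≤ 8(a⁴ + b⁴).
    refine tendsto_lintegral_zero_of_sq_le (C := 1 + 8 * (C + C))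
      (fun n => (hm n).ennreal_ofReal) (by finiteness) (fun n => ?_) ?_
    · calc ∫⁻ l, ENNReal.ofReal |phi μ ν l - phi μ (νs n) l| ^ 2 ∂μ
          ≤ ∫⁻ l, (1 + ENNReal.ofReal ((phi μ ν l - phi μ (νs n) l) ^ 4)) ∂μ := by
            refine lintegral_mono fun l => ?_
            dsimp only
            rw [← ENNReal.ofReal_pow (abs_nonneg _), sq_abs, ← ENNReal.ofReal_one,
              ← ENNReal.ofReal_add zero_le_one (by positivity)]
            refine ENNReal.ofReal_le_ofReal ?_
            nlinarith [sq_nonneg ((phi μ ν l - phi μ (νs n) l) ^ 2 - 1)]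
        _ = 1 + ∫⁻ l, ENNReal.ofReal ((phi μ ν l - phi μ (νs n) l) ^ 4) ∂μ := by
            rw [lintegral_add_left measurable_const]
            simp
        _ ≤ 1 + 8 * (C + C) := by
            gcongr
            exact h.lintegral_phi_sub_fourth_le ν (νs n) hν (hb n)
    · filter_upwards [hlim] with l hl
      have h1 : Tendsto (fun n => |phi μ ν l - phi μ (νs n) l|) atTop (𝓝 0) := by
        simpa using (hl.const_sub (phi μ ν l)).abs
      simpa using ENNReal.tendsto_ofReal h1
  have h2 := (ENNReal.tendsto_toReal ENNReal.zero_ne_top).comp key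
  refine h2.congr fun n => ?_
  rw [integral_eq_lintegral_of_nonneg_ae (ae_of_all _ fun l => abs_nonneg _)
    (hm n).aestronglyMeasurable]
  rfl

end Coupling

/-- The monotonicity defect D tends to 0 in L¹(μ), hence in measure; this is passed to the
conjugates, then to their subgradients φ, then to L² by fourth moments. -/
theorem tendsto_lintegral_sq_of_fixedPoints (h : IsBase μ) (hH : IsRiskFun H ε K)
    {lams νs : ℕ → Measure ℝ} {lam ν : Measure ℝ} [∀ n, IsProbabilityMeasure (lams n)]
    [∀ n, IsProbabilityMeasure (νs n)] [IsProbabilityMeasure lam] [IsProbabilityMeasure ν]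
    (hTs : ∀ n, T μ H (lams n) (νs n) = lams n) (hT : T μ H lam ν = lam) {C : ℝ≥0∞} (hC : C ≠ ∞)
    (hb : ∀ n, ∫⁻ x, ENNReal.ofReal (x ^ 4) ∂(lams n) ≤ C)
    (hlam : ∫⁻ x, ENNReal.ofReal (x ^ 4) ∂lam ≤ C)
    (hlim : ∀ᵐ l ∂μ, Tendsto (fun n => phi μ (lams n) l) atTop (𝓝 (phi μ lam l))) :
    Tendsto (fun n => ∫⁻ l, ENNReal.ofReal ((phi μ (νs n) l - phi μ ν l) ^ 2) ∂μ)
      atTop (𝓝 0) := by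
  have hi : Integrable (fun x : ℝ => x) lam :=
    integrable_of_fourth_moment (hlam.trans_lt hC.lt_top).ne
  have his : ∀ n, Integrable (fun x : ℝ => x) (lams n) := fun n =>
    integrable_of_fourth_moment ((hb n).trans_lt hC.lt_top).ne
  have habs := h.tendsto_integral_abs hC hb hlam hlim
  let D : ℕ → ℝ → ℝ := fun n l =>
    (deriv H (conj μ (lams n) (νs n) l) - deriv H (conj μ lam ν l)) *
      (conj μ (lams n) (νs n) l - conj μ lam ν l)
  have hDi : ∀ n, Integrable (D n) μ := fun n => by
    have hd := (h.integrable_conj (lam := lams n) (integrable_of_fixedPoint h hH (hTs n) (his n))).sub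
      (h.integrable_conj (lam := lam) (integrable_of_fixedPoint h hH hT hi))
    refine ((hH.integrable_deriv_mul (h.aemeasurable_conj (lams n) (νs n)) hd).sub
      (hH.integrable_deriv_mul (h.aemeasurable_conj lam ν) hd)).congr (ae_of_all _ fun l => ?_)
    simp only [D, Pi.sub_apply]
    ring
  have hDt : Tendsto (fun n => ∫ l, D n l ∂μ) atTop (𝓝 0) := by
    refine squeeze_zero (fun n => integral_nonneg fun l => hH.mul_nonneg _ _)
      (fun n => integral_mul_le_of_fixedPoints h hH hT (hTs n) hi (his n)) ?_
    simpa using habs.const_mul (2 * K)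
  have hDm : TendstoInMeasure μ D atTop (fun _ => (0 : ℝ)) := by
    refine tendstoInMeasure_of_tendsto_eLpNorm one_ne_zero
      (fun n => (hDi n).aestronglyMeasurable) aestronglyMeasurable_const ?_
    have h1 := ENNReal.tendsto_ofReal hDt
    rw [ENNReal.ofReal_zero] at h1
    refine h1.congr fun n => ?_
    rw [ofReal_integral_eq_lintegral_ofReal (hDi n) (ae_of_all _ fun l => hH.mul_nonneg _ _),
      eLpNorm_one_eq_lintegral_enorm]
    refine lintegral_congr fun l => ?_
    simp only [Pi.sub_apply, sub_zero]
    rw [Real.enorm_eq_ofReal (hH.mul_nonneg _ _)]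
  -- Convergence in measure gives almost everywhere convergence only along a subsequence, so every
  -- subsequence is refined.
  refine tendsto_of_subseq_tendsto fun ns hns => ?_
  have hDm' : TendstoInMeasure μ (fun n => D (ns n)) atTop (fun _ => (0 : ℝ)) :=
    fun e he => (hDm e he).comp hns
  obtain ⟨ms, -, hms⟩ := hDm'.exists_seq_tendsto_ae
  refine ⟨ms, ?_⟩
  have hφ := h.tendsto_phi_of_tendsto_conj (lams := fun n => lams (ns (ms n)))
    (νs := fun n => νs (ns (ms n))) (lam := lam) (ν := ν)
    (hms.mono fun l hl => hH.tendsto_of_mul_tendsto_zero hl)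
  have hm : Measurable fun x : ℝ => ENNReal.ofReal (x ^ 4) := by fun_prop
  refine h.tendsto_lintegral_sq (C := ENNReal.ofReal (K / ε) * C) (by finiteness) (fun n => ?_) ?_ hφ
  · exact (lintegral_le_of_fixedPoint h hH (hTs _) hm).trans (by gcongr; exact hb _)
  · exact (lintegral_le_of_fixedPoint h hH hT hm).trans (by gcongr)

end

section

/-! ### Random walks and the Gaussian limit -/

instance isProbabilityMeasure_fairSign : IsProbabilityMeasure fairSign := by
  constructor
  simp only [fairSign, Measure.add_apply, Measure.smul_apply, smul_eq_mul, measure_univ, mul_one]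
  exact ENNReal.inv_two_add_inv_two

instance isProbabilityMeasure_lambdaBar (n : ℕ) : IsProbabilityMeasure (lambdaBar n) :=
  Measure.isProbabilityMeasure_map (by fun_prop)

lemma integral_fairSign {E : Type*} [NormedAddCommGroup E] [NormedSpace ℝ E] [CompleteSpace E]
    (g : ℝ → E) : ∫ x, g x ∂fairSign = (2⁻¹ : ℝ) • (g 1 + g (-1)) := by
  have hi : ∀ x : ℝ, Integrable g ((2⁻¹ : ℝ≥0∞) • Measure.dirac x) := fun x =>
    (integrable_dirac (by finiteness)).smul_measure (by simp)
  rw [fairSign, integral_add_measure (hi _) (hi _), integral_smul_measure, integral_smul_measure,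
    integral_dirac, integral_dirac, smul_add]
  simp

/-- Independence, stated for any continuous multiplicative character so that it serves both the
characteristic function and the exponential moments. -/
lemma integral_lambdaBar_exp {𝕜 : Type*} [RCLike 𝕜] (n : ℕ) (e : ℝ → 𝕜) (he : Continuous e)
    (he0 : e 0 = 1) (hadd : ∀ x y, e (x + y) = e x * e y) :
    ∫ x, e x ∂(lambdaBar n) = (∫ u, e (u / √n) ∂fairSign) ^ n := by
  have hsum : ∀ (s : Finset (Fin n)) (u : Fin n → ℝ),
      e (∑ i ∈ s, u i / √n) = ∏ i ∈ s, e (u i / √n) := by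
    intro s u
    induction s using Finset.cons_induction with
    | empty => simpa using he0
    | cons a s ha ih => rw [Finset.sum_cons, Finset.prod_cons, hadd, ih]
  rw [lambdaBar, integral_map (by fun_prop) he.aestronglyMeasurable]
  simp_rw [Finset.sum_div, hsum]
  rw [integral_fintype_prod_eq_prod (fun _ : Fin n => fun u : ℝ => e (u / √n))]
  simp

lemma charFun_lambdaBar (n : ℕ) (t : ℝ) :
    charFun (lambdaBar n) t = (charFun fairSign ((√n)⁻¹ * t)) ^ n := by
  rw [charFun_apply_real, charFun_apply_real,
    integral_lambdaBar_exp n (fun x : ℝ => Complex.exp (t * x * Complex.I)) (by fun_prop) (by simp)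
      (fun x y => by rw [← Complex.exp_add]; push_cast; ring_nf)]
  congr 1
  refine integral_congr_ae (ae_of_all _ fun u => ?_)
  simp only
  congr 1
  push_cast
  ring

lemma integral_exp_mul_lambdaBar_le {n : ℕ} (hn : 1 ≤ n) (a : ℝ) :
    Integrable (fun x => Real.exp (a * x)) (lambdaBar n) ∧
      ∫ x, Real.exp (a * x) ∂(lambdaBar n) ≤ Real.exp (a ^ 2 / 2) := by
  have e : ∫ x, Real.exp (a * x) ∂(lambdaBar n) = Real.cosh (a / √n) ^ n := by
    rw [integral_lambdaBar_exp n (fun x : ℝ => Real.exp (a * x)) (by fun_prop) (by simp)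
      (fun x y => by rw [← Real.exp_add]; ring_nf), integral_fairSign, Real.cosh_eq]
    congr 1
    rw [smul_eq_mul]
    ring_nf
  constructor
  -- A non-integrable function has integral 0 by convention, which contradicts the positive value
  -- just computed.
  · by_contra hni
    rw [integral_undef hni] at e
    exact (pow_pos (Real.cosh_pos _) n).ne e
  · rw [e]
    calc Real.cosh (a / √n) ^ n ≤ Real.exp ((a / √n) ^ 2 / 2) ^ n := by
          gcongr
          exact Real.cosh_le_exp_half_sq _
      _ = Real.exp (a ^ 2 / 2) := by
          rw [← Real.exp_nat_mul, div_pow, Real.sq_sqrt (Nat.cast_nonneg n)]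
          congr 1
          have : (n : ℝ) ≠ 0 := by positivity
          field_simp

/-- From the exponential series, x⁴ ≤ 4! exp |x| ≤ 24 (exp x + exp (-x)). -/
lemma lintegral_pow_four_le (m : Measure ℝ) (h₁ : Integrable (fun x => Real.exp (1 * x)) m)
    (h₂ : Integrable (fun x => Real.exp (-1 * x)) m) :
    ∫⁻ x, ENNReal.ofReal (x ^ 4) ∂m
      ≤ ENNReal.ofReal (24 * (∫ x, Real.exp (1 * x) ∂m + ∫ x, Real.exp (-1 * x) ∂m)) := by
  rw [← integral_add h₁ h₂, ← integral_const_mul, ofReal_integral_eq_lintegral_ofReal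
    (show Integrable (fun x => 24 * (Real.exp (1 * x) + Real.exp (-1 * x))) m from
      (h₁.add h₂).const_mul 24) (ae_of_all _ fun x => by positivity)]
  refine lintegral_mono fun x => ENNReal.ofReal_le_ofReal ?_
  have h3 := Real.pow_div_factorial_le_exp |x| (abs_nonneg x) 4
  have h4 : |x| ^ 4 = x ^ 4 := by rw [show 4 = 2 * 2 by norm_num, pow_mul, pow_mul, sq_abs]
  rw [h4, div_le_iff₀ (by positivity)] at h3
  have h5 : ((Nat.factorial 4 : ℕ) : ℝ) = 24 := by norm_num [Nat.factorial]
  rw [h5] at h3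
  have h6 : Real.exp |x| ≤ Real.exp (1 * x) + Real.exp (-1 * x) := by
    rw [one_mul, neg_one_mul]
    exact Real.exp_abs_le x
  linarith

lemma lintegral_pow_four_lambdaBar_le {n : ℕ} (hn : 1 ≤ n) :
    ∫⁻ x, ENNReal.ofReal (x ^ 4) ∂(lambdaBar n)
      ≤ ENNReal.ofReal (24 * (Real.exp (1 / 2) + Real.exp (1 / 2))) := by
  obtain ⟨i₁, b₁⟩ := integral_exp_mul_lambdaBar_le hn 1
  obtain ⟨i₂, b₂⟩ := integral_exp_mul_lambdaBar_le hn (-1)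
  refine (lintegral_pow_four_le _ i₁ i₂).trans (ENNReal.ofReal_le_ofReal ?_)
  norm_num at b₁ b₂ ⊢
  linarith

lemma lintegral_pow_four_gaussian_lt_top :
    ∫⁻ x, ENNReal.ofReal (x ^ 4) ∂(gaussianReal 0 1) < ∞ :=
  (lintegral_pow_four_le _ (integrable_exp_mul_gaussianReal 1)
    (integrable_exp_mul_gaussianReal (-1))).trans_lt ENNReal.ofReal_lt_top

/-- Central limit theorem through characteristic functions, then the portmanteau theorem, as the
Gaussian has no atoms. -/
lemma tendsto_cdf_lambdaBar (x : ℝ) :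
    Tendsto (fun n => cdf (lambdaBar n) x) atTop (𝓝 (cdf (gaussianReal 0 1) x)) := by
  let P : ℕ → ProbabilityMeasure ℝ := fun n => ⟨lambdaBar n, inferInstance⟩
  let Q : ProbabilityMeasure ℝ := ⟨gaussianReal 0 1, inferInstance⟩
  have hPQ : Tendsto P atTop (𝓝 Q) := by
    refine ProbabilityMeasure.tendsto_iff_tendsto_charFun.2 fun t => ?_
    have h := tendsto_charFun_inv_sqrt_mul_pow (P := fairSign) (X := id) aemeasurable_id
      (by rw [integral_fairSign]; simp) (by rw [integral_fairSign]; norm_num) t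
    rw [Measure.map_id] at h
    simpa [P, Q, charFun_lambdaBar, charFun_gaussianReal, neg_div] using h
  have h0 : (Q : Measure ℝ) (frontier (Iic x)) = 0 := by
    have : NullSingletonClass (gaussianReal 0 1) := nullSingletonClass_gaussianReal one_ne_zero
    rw [frontier_Iic]
    exact measure_singleton (μ := gaussianReal 0 1) x
  have h1 := ProbabilityMeasure.tendsto_measure_of_null_frontier_of_tendsto' hPQ h0
  have h2 := (ENNReal.tendsto_toReal (measure_ne_top _ _)).comp h1
  simp_rw [cdf_eq_real]
  exact h2

lemma strictMono_cdf_gaussian : StrictMono (cdf (gaussianReal 0 1)) := by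
  intro x y hxy
  have h1 := cdf_sub_cdf (gaussianReal 0 1) hxy.le
  have h2 : gaussianReal 0 1 (Ioc x y) ≠ 0 := fun h0 => by
    have := gaussianReal_absolutelyContinuous' 0 one_ne_zero h0
    rw [Real.volume_Ioc, ENNReal.ofReal_eq_zero] at this
    linarith
  have h3 : 0 < (gaussianReal 0 1).real (Ioc x y) := ENNReal.toReal_pos h2 (measure_ne_top _ _)
  linarith

lemma continuous_cdf_gaussian : Continuous (cdf (gaussianReal 0 1)) :=
  have : NullSingletonClass (gaussianReal 0 1) := nullSingletonClass_gaussianReal one_ne_zero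
  continuous_cdf _

/-- A strictly increasing limit has no flat pieces, so quantiles converge at every level and not
merely at almost every one. -/
lemma tendsto_rightInv {νs : ℕ → Measure ℝ} {ν : Measure ℝ} (hν : StrictMono (cdf ν))
    (hlim : ∀ x, Tendsto (fun n => cdf (νs n) x) atTop (𝓝 (cdf ν x))) {y : ℝ}
    (hy : y ∈ Ioo (0 : ℝ) 1) : Tendsto (fun n => rightInv (νs n) y) atTop (𝓝 (rightInv ν y)) := by
  rw [tendsto_order]
  constructor
  · intro x hx
    obtain ⟨z, hxz, hz⟩ := exists_between hx
    obtain ⟨w, hzw, hw⟩ := exists_between hz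
    have h1 : cdf ν z < y := (hν hzw).trans_le (cdf_le_of_lt_rightInv ν hy.1 hw)
    filter_upwards [(hlim z).eventually_lt_const h1] with n hn
    refine hxz.trans_le (not_lt.1 fun hlt => ?_)
    exact absurd (lt_cdf_of_rightInv_lt (νs n) hy.2 hlt) (not_lt.2 hn.le)
  · intro x hx
    obtain ⟨z, hz, hzx⟩ := exists_between hx
    filter_upwards [(hlim z).eventually_const_lt (lt_cdf_of_rightInv_lt ν hy.2 hz)] with n hn
    exact (rightInv_le_of_lt_cdf (νs n) hy.1 hn).trans_lt hzx

end

section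

/-! ### Existence of a minimizing pair of potentials -/

/-- Compactness of a product of intervals gives convergence at all rationals; the common Lipschitz
constant extends it to all reals. -/
lemma exists_subseq_tendsto_of_lipschitzWith {Ψ : ℕ → ℝ → ℝ} (hL : ∀ n, LipschitzWith 1 (Ψ n))
    {B : ℝ} (hB : ∀ n, |Ψ n 0| ≤ B) :
    ∃ (Ψ₀ : ℝ → ℝ) (ms : ℕ → ℕ), StrictMono ms ∧ LipschitzWith 1 Ψ₀ ∧
      ∀ s, Tendsto (fun n => Ψ (ms n) s) atTop (𝓝 (Ψ₀ s)) := by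
  have hd : ∀ n x y, |Ψ n x - Ψ n y| ≤ |x - y| := fun n x y => by
    simpa [Real.dist_eq] using (hL n).dist_le_mul x y
  have hmem : ∀ n, (fun q : ℚ => Ψ n q) ∈
      Set.pi univ fun q : ℚ => Icc (-(B + |(q : ℝ)|)) (B + |(q : ℝ)|) := by
    intro n q _
    change Ψ n q ∈ Icc _ _
    rw [mem_Icc, ← abs_le]
    have h1 := hd n q 0
    have h2 := abs_sub_abs_le_abs_sub (Ψ n q) (Ψ n 0)
    rw [sub_zero] at h1
    linarith [hB n]
  obtain ⟨a, -, ms, hms, hlim⟩ := (isCompact_univ_pi fun q : ℚ =>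
    isCompact_Icc (a := -(B + |(q : ℝ)|)) (b := B + |(q : ℝ)|)).tendsto_subseq hmem
  rw [tendsto_pi_nhds] at hlim
  have hc : ∀ s, ∃ x, Tendsto (fun n => Ψ (ms n) s) atTop (𝓝 x) := by
    intro s
    refine cauchySeq_tendsto_of_complete (Metric.cauchySeq_iff.2 fun δ hδ => ?_)
    obtain ⟨q, hq1, hq2⟩ := exists_rat_btwn (lt_add_of_pos_right s (by positivity : 0 < δ / 3))
    obtain ⟨N, hN⟩ := Metric.cauchySeq_iff.1 (hlim q).cauchySeq (δ / 3) (by positivity)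
    refine ⟨N, fun m hm n hn => ?_⟩
    have h1 := hN m hm n hn
    have h2 := hd (ms m) s q
    have h3 := hd (ms n) q s
    simp only [Function.comp, Real.dist_eq] at h1 ⊢
    have h4 : |s - q| < δ / 3 := by rw [abs_lt]; constructor <;> linarith
    rw [abs_sub_comm (q : ℝ) s] at h3
    calc |Ψ (ms m) s - Ψ (ms n) s|
        ≤ |Ψ (ms m) s - Ψ (ms m) q| + |Ψ (ms m) q - Ψ (ms n) q| + |Ψ (ms n) q - Ψ (ms n) s| := by
          refine (abs_sub_le _ (Ψ (ms n) q) _).trans ?_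
          gcongr
          exact abs_sub_le _ _ _
      _ < δ := by linarith
  choose Ψ₀ hΨ₀ using hc
  refine ⟨Ψ₀, ms, hms, LipschitzWith.of_dist_le_mul fun x y => ?_, hΨ₀⟩
  exact le_of_tendsto' ((hΨ₀ x).dist (hΨ₀ y)) fun n => (hL (ms n)).dist_le_mul x y

namespace IsRiskFun

variable {H : ℝ → ℝ} {ε K : ℝ}

lemma strictMono (hH : IsRiskFun H ε K) : StrictMono H := strictMono_of_deriv_pos hH.deriv_pos

lemma continuous (hH : IsRiskFun H ε K) : Continuous H := hH.differentiable.continuous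

lemma abs_sub_le (hH : IsRiskFun H ε K) (x y : ℝ) : |H x - H y| ≤ K * |x - y| := by
  wlog hxy : y ≤ x generalizing x y
  · rw [abs_sub_comm, abs_sub_comm x]
    exact this y x (le_of_not_ge hxy)
  rw [abs_of_nonneg (sub_nonneg.2 (hH.strictMono.monotone hxy)), abs_of_nonneg (sub_nonneg.2 hxy)]
  exact image_sub_le_mul_sub_of_deriv_le hH.differentiable hH.deriv_le hxy

lemma le_abs_sub (hH : IsRiskFun H ε K) (x y : ℝ) : ε * |x - y| ≤ |H x - H y| := by
  wlog hxy : y ≤ x generalizing x y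
  · rw [abs_sub_comm, abs_sub_comm (H x)]
    exact this y x (le_of_not_ge hxy)
  rw [abs_of_nonneg (sub_nonneg.2 (hH.strictMono.monotone hxy)), abs_of_nonneg (sub_nonneg.2 hxy)]
  exact mul_sub_le_image_sub_of_le_deriv hH.differentiable hH.le_deriv hxy

lemma sub_le_deriv_mul (hH : IsRiskFun H ε K) (x y : ℝ) : H y - H x ≤ deriv H y * (y - x) := by
  have hc := Monotone.convexOn_univ_of_deriv hH.differentiable hH.strictMono_deriv.monotone
  rcases lt_trichotomy x y with hxy | rfl | hxy
  · have := hc.slope_le_deriv trivial trivial hxy (hH.differentiable y)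
    rwa [slope_def_field, div_le_iff₀ (sub_pos.2 hxy)] at this
  · simp
  · have := hc.deriv_le_slope trivial trivial hxy (hH.differentiable y)
    rw [slope_def_field, le_div_iff₀ (sub_pos.2 hxy)] at this
    linarith

lemma surjective (hH : IsRiskFun H ε K) : Function.Surjective H := by
  have hε := hH.pos
  refine hH.continuous.surjective ?_ ?_
  · refine tendsto_atTop_mono' atTop (f₁ := fun x => H 0 + ε * x) ?_ ?_
    · filter_upwards [eventually_ge_atTop 0] with x hx
      have := mul_sub_le_image_sub_of_le_deriv hH.differentiable hH.le_deriv hx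
      linarith
    · exact tendsto_atTop_add_const_left _ _ (tendsto_id.const_mul_atTop hε)
  · refine tendsto_atBot_mono' atBot (f₁ := fun x => H 0 + ε * x) ?_ ?_
    · filter_upwards [eventually_le_atBot 0] with x hx
      have := mul_sub_le_image_sub_of_le_deriv hH.differentiable hH.le_deriv hx
      linarith
    · exact tendsto_atBot_add_const_left _ _ (tendsto_id.const_mul_atBot hε)

lemma integrable_comp_iff (hH : IsRiskFun H ε K) {m : Measure ℝ} [IsFiniteMeasure m] {G : ℝ → ℝ}
    (hG : AEMeasurable G m) : Integrable (fun l => H (G l)) m ↔ Integrable G m := by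
  constructor
  · intro hi
    refine ((hi.sub (integrable_const (H 0))).norm.const_mul ε⁻¹).mono' hG.aestronglyMeasurable
      (ae_of_all _ fun l => ?_)
    have := hH.le_abs_sub (G l) 0
    rw [sub_zero] at this
    rw [inv_mul_eq_div, le_div_iff₀ hH.pos, mul_comm]
    exact this
  · intro hi
    have h1 : Integrable (fun l => H (G l) - H 0) m := by
      refine (hi.norm.const_mul K).mono'
        ((hH.continuous.measurable.comp_aemeasurable hG).sub_const _).aestronglyMeasurable
        (ae_of_all _ fun l => ?_)
      have := hH.abs_sub_le (G l) 0
      rwa [sub_zero] at this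
    exact (h1.add (integrable_const (H 0))).congr (ae_of_all _ fun l => by simp)

end IsRiskFun

/-- A pair of potentials: a `1`-Lipschitz function `Ψ` of mean zero for `lam`, and an integrable
upper bound `G` of its conjugate. -/
structure IsPair (μ lam : Measure ℝ) (Ψ G : ℝ → ℝ) : Prop where
  lipschitz : LipschitzWith 1 Ψ
  integral_eq_zero : ∫ s, Ψ s ∂lam = 0
  integrable : Integrable G μ
  le : ∀ᵐ l ∂μ, ∀ s, l * s - Ψ s ≤ G l

section Minimizer

variable {μ lam : Measure ℝ} {Ψ G : ℝ → ℝ}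

/-- Mean zero and the Lipschitz bound pin down the value at 0, as compactness requires. -/
lemma IsPair.abs_apply_zero_le [IsProbabilityMeasure lam] (hlam : Integrable (fun x : ℝ => x) lam)
    (h : IsPair μ lam Ψ G) : |Ψ 0| ≤ ∫ x, |x| ∂lam := by
  have hi := integrable_of_lipschitzWith h.lipschitz hlam
  have h1 : Ψ 0 = ∫ s, (Ψ 0 - Ψ s) ∂lam := by
    rw [integral_sub (integrable_const _) hi, h.integral_eq_zero]
    simp
  rw [h1]
  refine abs_integral_le_integral_abs.trans
    (integral_mono ((integrable_const _).sub hi).abs hlam.abs fun s => ?_)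
  simpa [Real.dist_eq] using h.lipschitz.dist_le_mul 0 s

/-- Taking G as an upper bound of the conjugate, rather than the conjugate itself, makes the
constraints convex. -/
lemma IsPair.convexComb [IsProbabilityMeasure lam] (hlam : Integrable (fun x : ℝ => x) lam)
    (h : IsPair μ lam Ψ G) {Ψ' G' : ℝ → ℝ} (h' : IsPair μ lam Ψ' G') {t : ℝ} (ht0 : 0 ≤ t)
    (ht1 : t ≤ 1) :
    IsPair μ lam (fun s => (1 - t) * Ψ s + t * Ψ' s) (fun l => G l + t * (G' l - G l)) := by
  refine ⟨LipschitzWith.of_dist_le_mul fun x y => ?_, ?_, ?_, ?_⟩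
  · have h1 := h.lipschitz.dist_le_mul x y
    have h2 := h'.lipschitz.dist_le_mul x y
    simp only [NNReal.coe_one, one_mul, Real.dist_eq] at h1 h2 ⊢
    calc |(1 - t) * Ψ x + t * Ψ' x - ((1 - t) * Ψ y + t * Ψ' y)|
        = |(1 - t) * (Ψ x - Ψ y) + t * (Ψ' x - Ψ' y)| := by ring_nf
      _ ≤ (1 - t) * |Ψ x - Ψ y| + t * |Ψ' x - Ψ' y| := by
          refine (abs_add_le _ _).trans (le_of_eq ?_)
          rw [abs_mul, abs_mul, abs_of_nonneg ht0, abs_of_nonneg (sub_nonneg.2 ht1)]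
      _ ≤ (1 - t) * |x - y| + t * |x - y| := by
          have := sub_nonneg.2 ht1
          gcongr
      _ = |x - y| := by ring
  · rw [integral_add ((integrable_of_lipschitzWith h.lipschitz hlam).const_mul _)
      ((integrable_of_lipschitzWith h'.lipschitz hlam).const_mul _), integral_const_mul,
      integral_const_mul, h.integral_eq_zero, h'.integral_eq_zero]
    simp
  · exact h.integrable.add ((h'.integrable.sub h.integrable).const_mul t)
  · filter_upwards [h.le, h'.le] with l hl hl' s
    have h1 := mul_le_mul_of_nonneg_left (hl s) (sub_nonneg.2 ht1)
    have h2 := mul_le_mul_of_nonneg_left (hl' s) ht0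
    linarith

variable [IsProbabilityMeasure μ] [IsProbabilityMeasure lam] {H : ℝ → ℝ} {ε K : ℝ}

lemma IsBase.isPair_conj (h : IsBase μ) (hlam : Integrable (fun x : ℝ => x) lam) :
    IsPair μ lam (Psi μ lam lam) (conj μ lam lam) :=
  ⟨h.lipschitzWith_Psi lam lam, h.integral_Psi lam lam hlam, h.integrable_conj hlam,
    h.ae_mem.mono fun _ hl => h.sub_Psi_le_conj lam lam hl⟩

/-- Direct method: the potentials converge pointwise along a subsequence, and Fatou's lemma handles
H(G). -/
lemma exists_minimizer (h : IsBase μ) (hH : IsRiskFun H ε K)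
    (hlam : Integrable (fun x : ℝ => x) lam) :
    ∃ Ψ G : ℝ → ℝ, IsPair μ lam Ψ G ∧
      ∀ Ψ' G' : ℝ → ℝ, IsPair μ lam Ψ' G' → ∫ l, H (G l) ∂μ ≤ ∫ l, H (G' l) ∂μ := by
  set B := ∫ x, |x| ∂lam
  -- Every admissible G satisfies G ≥ -Ψ(0) ≥ -B almost everywhere, so H(G) - c is nonnegative there
  -- and Fatou applies.
  set c := H (-B)
  let S : Set ℝ := {x | ∃ Ψ G : ℝ → ℝ, IsPair μ lam Ψ G ∧ x = ∫ l, H (G l) ∂μ}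
  have hHi : ∀ {Ψ G : ℝ → ℝ}, IsPair μ lam Ψ G → Integrable (fun l => H (G l)) μ :=
    fun hp => (hH.integrable_comp_iff hp.integrable.aemeasurable).2 hp.integrable
  have hlow : ∀ {Ψ G : ℝ → ℝ}, IsPair μ lam Ψ G → ∀ᵐ l ∂μ, c ≤ H (G l) := fun {Ψ G} hp => by
    filter_upwards [hp.le] with l hl
    refine hH.strictMono.monotone ?_
    have h1 := hl 0
    have h2 := le_abs_self (Ψ 0)
    have h3 := hp.abs_apply_zero_le hlam
    linarith
  have hSne : S.Nonempty := ⟨_, _, _, h.isPair_conj hlam, rfl⟩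
  have hSb : BddBelow S := by
    refine ⟨c, ?_⟩
    rintro x ⟨Ψ, G, hp, rfl⟩
    simpa using integral_mono_ae (integrable_const c) (hHi hp) (hlow hp)
  obtain ⟨u, -, hu, huS⟩ := exists_seq_tendsto_sInf hSne hSb
  choose Ψ G hp hJ using huS
  obtain ⟨Ψ₀, ms, hms, hL, hlim⟩ := exists_subseq_tendsto_of_lipschitzWith
    (fun n => (hp n).lipschitz) (fun n => (hp n).abs_apply_zero_le hlam)
  have hΨ₀ : ∫ s, Ψ₀ s ∂lam = 0 := by
    have h1 : Tendsto (fun n => ∫ s, Ψ (ms n) s ∂lam) atTop (𝓝 (∫ s, Ψ₀ s ∂lam)) := by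
      refine tendsto_integral_of_dominated_convergence (fun s => B + |s|)
        (fun n => (hp _).lipschitz.continuous.aestronglyMeasurable)
        ((integrable_const B).add hlam.abs) (fun n => ae_of_all _ fun s => ?_)
        (ae_of_all _ fun s => hlim s)
      have h1 := (hp (ms n)).lipschitz.dist_le_mul s 0
      rw [NNReal.coe_one, one_mul, Real.dist_eq, Real.dist_eq, sub_zero] at h1
      have h2 := abs_sub_abs_le_abs_sub (Ψ (ms n) s) (Ψ (ms n) 0)
      have h3 := (hp (ms n)).abs_apply_zero_le hlam
      rw [Real.norm_eq_abs]
      linarith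
    refine tendsto_nhds_unique h1 ?_
    simp_rw [(hp _).integral_eq_zero]
    exact tendsto_const_nhds
  let w : ℕ → ℝ → ℝ≥0∞ := fun n l =>
    ENNReal.ofReal (H ((hp (ms n)).integrable.aemeasurable.mk _ l) - c)
  have hwm : ∀ n, Measurable (w n) := fun n =>
    ((hH.continuous.measurable.comp (AEMeasurable.measurable_mk _)).sub_const c).ennreal_ofReal
  have hwG : ∀ᵐ l ∂μ, ∀ n, w n l = ENNReal.ofReal (H (G (ms n) l) - c) := by
    rw [ae_all_iff]
    intro n
    filter_upwards [(hp (ms n)).integrable.aemeasurable.ae_eq_mk] with l hl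
    simp only [w, ← hl]
  let v : ℝ → ℝ≥0∞ := fun l => liminf (fun n => w n l) atTop
  have hvm : Measurable v := Measurable.liminf hwm
  have hm0 : c ≤ sInf S := le_csInf hSne fun x ⟨Ψ, G, hp, hx⟩ => by
    rw [hx]
    simpa using integral_mono_ae (integrable_const c) (hHi hp) (hlow hp)
  have hvint : ∫⁻ l, v l ∂μ ≤ ENNReal.ofReal (sInf S - c) := by
    refine (lintegral_liminf_le hwm).trans (le_of_eq ?_)
    refine Tendsto.liminf_eq ?_
    refine (ENNReal.tendsto_ofReal ((hu.comp hms.tendsto_atTop).sub_const c)).congr fun n => ?_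
    have h1 : u (ms n) - c = ∫ l, (H (G (ms n) l) - c) ∂μ := by
      rw [integral_sub (hHi (hp _)) (integrable_const c), hJ]
      simp
    rw [Function.comp, h1, ofReal_integral_eq_lintegral_ofReal
      (show Integrable (fun l => H (G (ms n) l) - c) μ from (hHi (hp _)).sub (integrable_const c))
      ((hlow (hp (ms n))).mono fun l hl => sub_nonneg.2 hl)]
    exact lintegral_congr_ae (hwG.mono fun l hl => (hl n).symm)
  have hvfin : ∫⁻ l, v l ∂μ ≠ ∞ := (hvint.trans_lt ENNReal.ofReal_lt_top).ne
  have hvi : Integrable (fun l => (v l).toReal) μ :=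
    integrable_toReal_of_lintegral_ne_top hvm.aemeasurable hvfin
  let Hi : ℝ → ℝ := Function.surjInv hH.surjective
  have hHi_eq : ∀ y, H (Hi y) = y := Function.surjInv_eq hH.surjective
  have hHi_mono : Monotone Hi := fun x y hxy => by
    rwa [← hH.strictMono.le_iff_le, hHi_eq, hHi_eq]
  -- The lower limit is taken of H(G) and then inverted through H, so the cost of the limit is given
  -- directly by Fatou.
  let G₀ : ℝ → ℝ := fun l => Hi (c + (v l).toReal)
  have hG₀m : Measurable G₀ := hHi_mono.measurable.comp (hvm.ennreal_toReal.const_add c)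
  have hG₀ : ∀ l, H (G₀ l) = c + (v l).toReal := fun l => hHi_eq _
  refine ⟨Ψ₀, G₀, ⟨hL, hΨ₀, ?_, ?_⟩, ?_⟩
  · rw [← hH.integrable_comp_iff hG₀m.aemeasurable]
    simp_rw [hG₀]
    exact (integrable_const c).add hvi
  · have hle : ∀ᵐ l ∂μ, ∀ n, ∀ s, l * s - Ψ (ms n) s ≤ G (ms n) l :=
      ae_all_iff.2 fun n => (hp (ms n)).le
    filter_upwards [hle, hwG, ae_lt_top hvm hvfin] with l hl hw hv s
    rw [← hH.strictMono.le_iff_le, hG₀]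
    have h1 : Tendsto (fun n => ENNReal.ofReal (H (l * s - Ψ (ms n) s) - c)) atTop
        (𝓝 (ENNReal.ofReal (H (l * s - Ψ₀ s) - c))) :=
      ENNReal.tendsto_ofReal (((hH.continuous.tendsto _).comp ((hlim s).const_sub _)).sub_const c)
    have h2 : ENNReal.ofReal (H (l * s - Ψ₀ s) - c) ≤ v l := by
      rw [← h1.liminf_eq]
      refine liminf_le_liminf (Eventually.of_forall fun n => ?_)
      rw [hw n]
      exact ENNReal.ofReal_le_ofReal (sub_le_sub_right (hH.strictMono.monotone (hl n s)) c)
    have h3 := (ENNReal.ofReal_le_iff_le_toReal hv.ne).1 h2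
    linarith
  · intro Ψ' G' hp'
    refine le_trans ?_ (csInf_le hSb ⟨Ψ', G', hp', rfl⟩)
    simp_rw [hG₀]
    rw [integral_add (integrable_const c) hvi, integral_toReal hvm.aemeasurable
      (ae_lt_top hvm hvfin)]
    have := ENNReal.toReal_le_of_le_ofReal (sub_nonneg.2 hm0) hvint
    simp only [integral_const, probReal_univ, smul_eq_mul, one_mul]
    linarith

lemma integral_deriv_mul_nonneg_of_minimizer (hH : IsRiskFun H ε K)
    (hlam : Integrable (fun x : ℝ => x) lam) (hp : IsPair μ lam Ψ G)
    (hmin : ∀ Ψ' G' : ℝ → ℝ, IsPair μ lam Ψ' G' → ∫ l, H (G l) ∂μ ≤ ∫ l, H (G' l) ∂μ)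
    {Ψ' G' : ℝ → ℝ} (hp' : IsPair μ lam Ψ' G') :
    0 ≤ ∫ l, deriv H (G l) * (G' l - G l) ∂μ := by
  have hD := hp'.integrable.sub hp.integrable
  let t : ℕ → ℝ := fun n => 1 / ((n : ℝ) + 1)
  have ht : Tendsto t atTop (𝓝 0) := tendsto_one_div_add_atTop_nhds_zero_nat
  have ht0 : ∀ n, 0 < t n := fun n => by positivity
  have ht1 : ∀ n, t n ≤ 1 := fun n => by
    simp only [t]
    rw [div_le_one (by positivity)]
    linarith [(Nat.cast_nonneg n : (0 : ℝ) ≤ n)]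
  have hm : ∀ n, AEMeasurable (fun l => G l + t n * (G' l - G l)) μ := fun n =>
    hp.integrable.aemeasurable.add (hD.aemeasurable.const_mul (t n))
  have hlim : Tendsto (fun n => ∫ l, deriv H (G l + t n * (G' l - G l)) * (G' l - G l) ∂μ) atTop
      (𝓝 (∫ l, deriv H (G l) * (G' l - G l) ∂μ)) := by
    refine tendsto_integral_of_dominated_convergence (fun l => K * ‖G' l - G l‖)
      (fun n => (hH.integrable_deriv_mul (hm n) hD).aestronglyMeasurable)
      (hD.norm.const_mul K) (fun n => ae_of_all _ fun l => ?_) (ae_of_all _ fun l => ?_)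
    · rw [norm_mul]
      gcongr
      exact hH.abs_deriv_le _
    · refine Tendsto.mul_const _ ((hH.continuous_deriv.tendsto _).comp ?_)
      simpa using (ht.mul_const (G' l - G l)).const_add (G l)
  refine ge_of_tendsto' hlim fun n => ?_
  have hpn := hp.convexComb hlam hp' (ht0 n).le (ht1 n)
  have h1 := hmin _ _ hpn
  have i1 := (hH.integrable_comp_iff hp.integrable.aemeasurable).2 hp.integrable
  have i2 := (hH.integrable_comp_iff hpn.integrable.aemeasurable).2 hpn.integrable
  -- By convexity, the nonnegative cost increment is at most t times the integral with H' taken at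
  -- the perturbed point; dividing by t and letting t tend to 0 gives the claim.
  have h2 : ∫ l, (H (G l + t n * (G' l - G l)) - H (G l)) ∂μ
      ≤ ∫ l, t n * (deriv H (G l + t n * (G' l - G l)) * (G' l - G l)) ∂μ := by
    refine integral_mono (i2.sub i1) ((hH.integrable_deriv_mul (hm n) hD).const_mul _) fun l => ?_
    have := hH.sub_le_deriv_mul (G l) (G l + t n * (G' l - G l))
    dsimp only
    linarith
  rw [integral_sub i2 i1, integral_const_mul] at h2
  by_contra hneg
  nlinarith [mul_neg_of_pos_of_neg (ht0 n) (not_le.1 hneg)]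

end Minimizer

end

section

/-! ### Transport to a measure with a continuous strictly increasing distribution function -/

section Regular

variable {lam : Measure ℝ}

lemma rightInv_cdf_self (hs : StrictMono (cdf lam)) (s : ℝ) : rightInv lam (cdf lam s) = s := by
  have : {x : ℝ | cdf lam s < cdf lam x} = Ioi s := by
    ext x
    exact hs.lt_iff_lt
  rw [rightInv, this, csInf_Ioi]

lemma cdf_mem_Ioo (hs : StrictMono (cdf lam)) (s : ℝ) : cdf lam s ∈ Ioo (0 : ℝ) 1 :=
  ⟨(cdf_nonneg lam (s - 1)).trans_lt (hs (by linarith)),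
    (hs (lt_add_one s)).trans_le (cdf_le_one lam (s + 1))⟩

lemma exists_cdf_eq_of_continuous (hc : Continuous (cdf lam)) {y : ℝ} (hy : y ∈ Ioo (0 : ℝ) 1) :
    ∃ s, cdf lam s = y :=
  mem_range_of_exists_le_of_exists_ge hc
    (((tendsto_cdf_atBot lam).eventually_lt_const hy.1).exists.imp fun _ h => h.le)
    (((tendsto_cdf_atTop lam).eventually_const_lt hy.2).exists.imp fun _ h => h.le)

end Regular

namespace IsBase

variable {μ : Measure ℝ} [IsProbabilityMeasure μ] {lam : Measure ℝ}

lemma cdf_lt_cdf_left (h : IsBase μ) {x z : ℝ} (hz : z ∈ Ioo (0 : ℝ) 1) (hxz : x < z) :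
    cdf μ x < cdf μ z :=
  (monotone_cdf μ (le_max_left x 0)).trans_lt (h.strictMonoOn_cdf
    ⟨le_max_right _ _, (max_lt hxz hz.1).le.trans hz.2.le⟩ (Ioo_subset_Icc_self hz)
    (max_lt hxz hz.1))

lemma cdf_lt_cdf_right (h : IsBase μ) {x z : ℝ} (hz : z ∈ Ioo (0 : ℝ) 1) (hzx : z < x) :
    cdf μ z < cdf μ x :=
  (h.strictMonoOn_cdf (Ioo_subset_Icc_self hz)
    ⟨hz.1.le.trans (lt_min hzx hz.2).le, min_le_right _ _⟩
    (lt_min hzx hz.2)).trans_le (monotone_cdf μ (min_le_left x 1))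

lemma rightInv_cdf (h : IsBase μ) {z : ℝ} (hz : z ∈ Ioo (0 : ℝ) 1) :
    rightInv μ (cdf μ z) = z := by
  have : {x : ℝ | cdf μ z < cdf μ x} = Ioi z := by
    ext x
    exact ⟨fun hx => lt_of_cdf_lt hx, fun hx => h.cdf_lt_cdf_right hz hx⟩
  rw [rightInv, this, csInf_Ioi]

lemma gam_mem_and_cdf_gam (h : IsBase μ) (hs : StrictMono (cdf lam)) (s : ℝ) :
    gam μ lam s ∈ Ioo (0 : ℝ) 1 ∧ cdf μ (gam μ lam s) = cdf lam s := by
  have hy := cdf_mem_Ioo hs s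
  obtain ⟨x, hx, hxy⟩ := h.exists_cdf_eq (Ioo_subset_Icc_self hy)
  have hx' : x ∈ Ioo (0 : ℝ) 1 := by
    refine ⟨hx.1.lt_of_ne ?_, hx.2.lt_of_ne ?_⟩
    · rintro rfl
      exact hy.1.ne (h.cdf_zero.symm.trans hxy)
    · rintro rfl
      exact hy.2.ne (hxy.symm.trans h.cdf_one)
  have hg : gam μ lam s = x := by
    rw [gam, if_pos hy.2, ← hxy, h.rightInv_cdf hx']
  rw [hg]
  exact ⟨hx', hxy⟩

lemma cdf_phi (h : IsBase μ) (hc : Continuous (cdf lam)) (hs : StrictMono (cdf lam)) {l : ℝ}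
    (hl : l ∈ Ioo (0 : ℝ) 1) : cdf lam (phi μ lam l) = cdf μ l := by
  obtain ⟨s, hsy⟩ := exists_cdf_eq_of_continuous hc (h.cdf_mem hl)
  rw [phi, ← hsy, rightInv_cdf_self hs]

lemma lt_gam_iff (h : IsBase μ) (hc : Continuous (cdf lam)) (hs : StrictMono (cdf lam)) {l : ℝ}
    (hl : l ∈ Ioo (0 : ℝ) 1) (s : ℝ) : l < gam μ lam s ↔ phi μ lam l < s := by
  obtain ⟨hg, hgs⟩ := h.gam_mem_and_cdf_gam hs s
  rw [← hs.lt_iff_lt (b := s), h.cdf_phi hc hs hl, ← hgs,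
    h.strictMonoOn_cdf.lt_iff_lt (Ioo_subset_Icc_self hl) (Ioo_subset_Icc_self hg)]

lemma gam_phi (h : IsBase μ) (hc : Continuous (cdf lam)) (hs : StrictMono (cdf lam)) {l : ℝ}
    (hl : l ∈ Ioo (0 : ℝ) 1) : gam μ lam (phi μ lam l) = l := by
  obtain ⟨hg, hgs⟩ := h.gam_mem_and_cdf_gam hs (phi μ lam l)
  rw [h.cdf_phi hc hs hl] at hgs
  exact h.strictMonoOn_cdf.injOn (Ioo_subset_Icc_self hg) (Ioo_subset_Icc_self hl) hgs

lemma phi_gam (h : IsBase μ) (hs : StrictMono (cdf lam)) (s : ℝ) :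
    phi μ lam (gam μ lam s) = s := by
  rw [phi, (h.gam_mem_and_cdf_gam hs s).2, rightInv_cdf_self hs]

lemma continuous_gam (h : IsBase μ) (hc : Continuous (cdf lam)) (hs : StrictMono (cdf lam)) :
    Continuous (gam μ lam) := by
  rw [continuous_iff_continuousAt]
  intro s
  obtain ⟨hg, hgs⟩ := h.gam_mem_and_cdf_gam hs s
  refine tendsto_order.2 ⟨fun x hx => ?_, fun x hx => ?_⟩
  · have h1 := h.cdf_lt_cdf_left hg hx
    rw [hgs] at h1
    filter_upwards [(hc.tendsto s).eventually_const_lt h1] with t ht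
    rw [← (h.gam_mem_and_cdf_gam hs t).2] at ht
    exact lt_of_cdf_lt ht
  · have h1 := h.cdf_lt_cdf_right hg hx
    rw [hgs] at h1
    filter_upwards [(hc.tendsto s).eventually_lt_const h1] with t ht
    rw [← (h.gam_mem_and_cdf_gam hs t).2] at ht
    exact lt_of_cdf_lt ht

end IsBase

/-- The bound makes the derivative of D vanish everywhere. It is applied to the difference of two
functions sharing a continuous subgradient. -/
lemma eq_of_abs_sub_le_mul {D g : ℝ → ℝ} (hg : Continuous g)
    (hD : ∀ s t, |D s - D t| ≤ |g s - g t| * |s - t|) (x y : ℝ) : D x = D y := by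
  have hd : ∀ t, HasDerivAt D 0 t := by
    intro t
    rw [hasDerivAt_iff_isLittleO, Asymptotics.isLittleO_iff]
    intro c hc
    filter_upwards [Metric.tendsto_nhds.1 (hg.tendsto t) c hc] with s hs
    rw [smul_zero, sub_zero, Real.norm_eq_abs, Real.norm_eq_abs]
    rw [Real.dist_eq] at hs
    exact (hD s t).trans (by gcongr)
  exact is_const_of_deriv_eq_zero (fun t => (hd t).differentiableAt) (fun t => (hd t).deriv) x y

lemma abs_sub_sub_le_of_subgradient {Ψ₁ Ψ₂ g : ℝ → ℝ}
    (h₁ : ∀ t s, Ψ₁ t + g t * (s - t) ≤ Ψ₁ s) (h₂ : ∀ t s, Ψ₂ t + g t * (s - t) ≤ Ψ₂ s) (s t : ℝ) :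
    |(Ψ₁ s - Ψ₂ s) - (Ψ₁ t - Ψ₂ t)| ≤ |g s - g t| * |s - t| := by
  rw [← abs_mul]
  refine le_trans ?_ (le_abs_self _)
  have a₁ := h₁ t s
  have b₁ := h₁ s t
  have a₂ := h₂ t s
  have b₂ := h₂ s t
  rw [abs_le]
  constructor <;> linarith

/-! ### Existence of a fixed point -/

section Existence

variable {μ : Measure ℝ} [IsProbabilityMeasure μ] {H : ℝ → ℝ} {ε K : ℝ}

section Tilt

variable {G : ℝ → ℝ}

/-- The probability measure with density proportional to `H' ∘ G` with respect to `μ`. -/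
def tilt (μ : Measure ℝ) (H G : ℝ → ℝ) : Measure ℝ :=
  μ.withDensity fun l => ENNReal.ofReal ((∫ x, deriv H (G x) ∂μ)⁻¹ * deriv H (G l))

lemma tilt_density_pos (hH : IsRiskFun H ε K) (hG : AEMeasurable G μ) (l : ℝ) :
    0 < (∫ x, deriv H (G x) ∂μ)⁻¹ * deriv H (G l) :=
  mul_pos (inv_pos.2 (hH.pos.trans_le (hH.integral_deriv_comp_mem hG).1)) (hH.deriv_pos _)

lemma aemeasurable_tilt_density (hH : IsRiskFun H ε K) (hG : AEMeasurable G μ) :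
    AEMeasurable (fun l => ENNReal.ofReal ((∫ x, deriv H (G x) ∂μ)⁻¹ * deriv H (G l))) μ :=
  ((hH.integrable_deriv_comp hG).aemeasurable.const_mul _).ennreal_ofReal

lemma tilt_absolutelyContinuous {μ : Measure ℝ} : tilt μ H G ≪ μ := withDensity_absolutelyContinuous _ _

lemma absolutelyContinuous_tilt (hH : IsRiskFun H ε K) (hG : AEMeasurable G μ) :
    μ ≪ tilt μ H G :=
  withDensity_absolutelyContinuous' (aemeasurable_tilt_density hH hG)
    (ae_of_all _ fun l => (ENNReal.ofReal_pos.2 (tilt_density_pos hH hG l)).ne')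

lemma IsBase.tilt (h : IsBase μ) (hH : IsRiskFun H ε K) (hG : AEMeasurable G μ) :
    IsBase (tilt μ H G) :=
  ⟨tilt_absolutelyContinuous.trans h.ac, h.ac'.trans (absolutelyContinuous_tilt hH hG)⟩

lemma integral_tilt (hH : IsRiskFun H ε K) (hG : AEMeasurable G μ) (g : ℝ → ℝ) :
    ∫ l, g l ∂(tilt μ H G) = (∫ x, deriv H (G x) ∂μ)⁻¹ * ∫ l, deriv H (G l) * g l ∂μ := by
  rw [tilt, integral_withDensity_eq_integral_toReal_smul₀ (aemeasurable_tilt_density hH hG)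
    (ae_of_all _ fun _ => ENNReal.ofReal_lt_top), ← integral_const_mul]
  refine integral_congr_ae (ae_of_all _ fun l => ?_)
  simp only [smul_eq_mul]
  rw [ENNReal.toReal_ofReal (tilt_density_pos hH hG l).le, mul_assoc]

lemma isProbabilityMeasure_tilt (hH : IsRiskFun H ε K) (hG : AEMeasurable G μ) :
    IsProbabilityMeasure (tilt μ H G) := by
  constructor
  have hi := hH.integrable_deriv_comp hG
  rw [tilt, withDensity_apply _ MeasurableSet.univ, Measure.restrict_univ,
    ← ofReal_integral_eq_lintegral_ofReal (hi.const_mul _)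
      (ae_of_all _ fun l => (tilt_density_pos hH hG l).le), integral_const_mul,
    inv_mul_cancel₀ (hH.pos.trans_le (hH.integral_deriv_comp_mem hG).1).ne', ENNReal.ofReal_one]

/-- The density is bounded above and bounded away from zero. -/
lemma integrable_tilt_iff (hH : IsRiskFun H ε K) (hG : AEMeasurable G μ) {g : ℝ → ℝ} :
    Integrable g (tilt μ H G) ↔ Integrable g μ := by
  have ha := hH.pos.trans_le (hH.integral_deriv_comp_mem hG).1
  have key : Integrable g (tilt μ H G) ↔ Integrable (fun l => deriv H (G l) * g l) μ := by
    rw [tilt, integrable_withDensity_iff_integrable_smul₀' (aemeasurable_tilt_density hH hG)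
      (ae_of_all _ fun _ => ENNReal.ofReal_lt_top)]
    simp_rw [ENNReal.toReal_ofReal (tilt_density_pos hH hG _).le, smul_eq_mul, mul_assoc]
    exact integrable_const_mul_iff (inv_pos.2 ha).ne'.isUnit _
  rw [key]
  refine ⟨fun hi => ?_, fun hi => hH.integrable_deriv_mul hG hi⟩
  have h1 : AEStronglyMeasurable (fun l => (deriv H (G l))⁻¹) μ :=
    (hH.integrable_deriv_comp hG).aemeasurable.inv.aestronglyMeasurable
  refine (hi.bdd_mul (c := ε⁻¹) h1 (ae_of_all _ fun l => ?_)).congr (ae_of_all _ fun l => ?_)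
  · rw [norm_inv, Real.norm_eq_abs, abs_of_pos (hH.deriv_pos _)]
    exact inv_anti₀ hH.pos (hH.le_deriv _)
  · exact inv_mul_cancel_left₀ (hH.deriv_pos _).ne' _

end Tilt

variable {lam : Measure ℝ}

/-- The transport from `Q` to `lam` is also the transport from `μ` to the image of `μ` under it. -/
lemma phi_gam_map (h : IsBase μ) {Q : Measure ℝ} [IsProbabilityMeasure Q] (hQ : IsBase Q)
    (hμQ : μ ≪ Q) (hc : Continuous (cdf lam)) (hs : StrictMono (cdf lam)) :
    (∀ l ∈ Ioo (0 : ℝ) 1, phi μ (μ.map (phi Q lam)) l = phi Q lam l) ∧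
      gam μ (μ.map (phi Q lam)) = gam Q lam := by
  have hm : AEMeasurable (phi Q lam) μ := (hQ.aemeasurable_phi lam).mono_ac hμQ
  have : IsProbabilityMeasure (μ.map (phi Q lam)) := Measure.isProbabilityMeasure_map hm
  have hg := fun s => (hQ.gam_mem_and_cdf_gam hs s).1
  -- `phi Q lam` and `gam Q lam` are mutually inverse increasing maps, so φ ≤ s means l ≤ γ(s).
  have hcdf : ∀ s, cdf (μ.map (phi Q lam)) s = cdf μ (gam Q lam s) := by
    intro s
    rw [cdf_eq_real, cdf_eq_real, measureReal_def, measureReal_def,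
      Measure.map_apply_of_aemeasurable hm measurableSet_Iic]
    congr 1
    refine measure_congr ?_
    filter_upwards [h.ae_mem] with l hl
    refine propext (?_ : phi Q lam l ≤ s ↔ l ≤ gam Q lam s)
    rw [← hs.le_iff_le, hQ.cdf_phi hc hs hl, ← (hQ.gam_mem_and_cdf_gam hs s).2,
      hQ.strictMonoOn_cdf.le_iff_le (Ioo_subset_Icc_self hl) (Ioo_subset_Icc_self (hg s))]
  constructor
  · intro l hl
    have hset : {x : ℝ | cdf μ l < cdf (μ.map (phi Q lam)) x} = Ioi (phi Q lam l) := by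
      ext x
      rw [mem_ofPred_eq, hcdf, h.strictMonoOn_cdf.lt_iff_lt (Ioo_subset_Icc_self hl)
        (Ioo_subset_Icc_self (hg x)), hQ.lt_gam_iff hc hs hl, mem_Ioi]
    rw [phi, rightInv, hset, csInf_Ioi]
  · funext s
    rw [gam, hcdf, if_pos (h.cdf_mem (hg s)).2, h.rightInv_cdf (hg s)]

theorem exists_fixedPoint [IsProbabilityMeasure lam] (h : IsBase μ) (hH : IsRiskFun H ε K)
    (hlam : Integrable (fun x : ℝ => x) lam) (hc : Continuous (cdf lam))
    (hs : StrictMono (cdf lam)) :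
    ∃ ν : Measure ℝ, IsProbabilityMeasure ν ∧ T μ H lam ν = lam := by
  obtain ⟨Ψ, G, hp, hmin⟩ := exists_minimizer h hH hlam
  have hG := hp.integrable.aemeasurable
  set Q := tilt μ H G with hQdef
  have hQ : IsBase Q := h.tilt hH hG
  have : IsProbabilityMeasure Q := isProbabilityMeasure_tilt hH hG
  have hμQ : μ ≪ Q := absolutelyContinuous_tilt hH hG
  have ha := hH.pos.trans_le (hH.integral_deriv_comp_mem hG).1
  have hpQ := hQ.isPair_conj hlam
  have hGt : Integrable (conj Q lam lam) μ := (integrable_tilt_iff hH hG).1 hpQ.integrable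
  have hpt : IsPair μ lam (Psi Q lam lam) (conj Q lam lam) :=
    ⟨hpQ.lipschitz, hpQ.integral_eq_zero, hGt, hμQ.ae_le hpQ.le⟩
  have hGQ : Integrable G Q := (integrable_tilt_iff hH hG).2 hp.integrable
  have i1 := hQ.integrable_mul_phi hlam
  have i2 : ∀ {g : ℝ → ℝ}, LipschitzWith 1 g → Integrable (fun l => g (phi Q lam l)) Q :=
    fun hg => hQ.integrable_comp_phi hlam hg
  have e2 : ∀ {g : ℝ → ℝ}, LipschitzWith 1 g → ∫ l, g (phi Q lam l) ∂Q = ∫ s, g s ∂lam :=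
    fun hg => by
      conv_rhs => rw [← hQ.map_phi lam, integral_map (hQ.aemeasurable_phi lam)
        hg.continuous.aestronglyMeasurable]
  -- Optimality against the Kantorovich potentials of the transport from Q to λ, whose conjugate has
  -- Q-integral equal to the transport reward.
  have hle : ∫ l, G l ∂Q ≤ ∫ l, l * phi Q lam l ∂Q := by
    have h1 := integral_deriv_mul_nonneg_of_minimizer hH hlam hp hmin hpt
    have h2 : ∫ l, (conj Q lam lam l - G l) ∂Q = _ := integral_tilt hH hG _
    rw [integral_sub hpQ.integrable hGQ] at h2
    have h3 : ∫ l, conj Q lam lam l ∂Q = ∫ l, l * phi Q lam l ∂Q := by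
      unfold conj
      rw [integral_sub i1 (i2 hpQ.lipschitz), e2 hpQ.lipschitz, hpQ.integral_eq_zero, sub_zero]
    have h4 := mul_nonneg (inv_pos.2 ha).le h1
    linarith
  have hleQ : ∀ᵐ l ∂Q, ∀ s, l * s - Ψ s ≤ G l := tilt_absolutelyContinuous.ae_le hp.le
  -- The difference is nonnegative and, since Ψ has mean zero under λ, its Q-integral is at most
  -- zero: complementary slackness.
  have heq : ∀ᵐ l ∂Q, G l = l * phi Q lam l - Ψ (phi Q lam l) := by
    have hf : 0 ≤ᵐ[Q] fun l => G l - (l * phi Q lam l - Ψ (phi Q lam l)) := by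
      filter_upwards [hleQ] with l hl
      exact sub_nonneg.2 (hl (phi Q lam l))
    have i3 : Integrable (fun l => l * phi Q lam l - Ψ (phi Q lam l)) Q :=
      i1.sub (i2 hp.lipschitz)
    have hfi : Integrable (fun l => G l - (l * phi Q lam l - Ψ (phi Q lam l))) Q := hGQ.sub i3
    have h0 : ∫ l, (G l - (l * phi Q lam l - Ψ (phi Q lam l))) ∂Q = 0 := by
      refine le_antisymm ?_ (integral_nonneg_of_ae hf)
      rw [integral_sub hGQ i3, integral_sub i1 (i2 hp.lipschitz),
        e2 hp.lipschitz, hp.integral_eq_zero]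
      linarith
    filter_upwards [(integral_eq_zero_iff_of_nonneg_ae hf hfi).1 h0] with l hl
    exact sub_eq_zero.1 hl
  -- Equality in Fenchel–Young makes l a subgradient of Ψ at φ(l) for almost every l. Such points
  -- are dense, and continuity of γ closes the set.
  have hsub : ∀ t s, Ψ t + gam Q lam t * (s - t) ≤ Ψ s := by
    have hcont := hQ.continuous_gam hc hs
    have hclosed : IsClosed {t | ∀ s, Ψ t + gam Q lam t * (s - t) ≤ Ψ s} := by
      simp only [ofPred_forall]
      have := hp.lipschitz.continuous
      exact isClosed_iInter fun s => isClosed_le (by fun_prop) continuous_const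
    have hdense : Dense {t | ∀ s, Ψ t + gam Q lam t * (s - t) ≤ Ψ s} := by
      refine dense_of_exists_between fun a b hab => ?_
      obtain ⟨ha, hca⟩ := hQ.gam_mem_and_cdf_gam hs a
      obtain ⟨hb, hcb⟩ := hQ.gam_mem_and_cdf_gam hs b
      have hlt : gam Q lam a < gam Q lam b := IsBase.lt_of_cdf_lt (by rw [hca, hcb]; exact hs hab)
      obtain ⟨l, hl, h1, h2⟩ := hQ.exists_mem_Ioo_of_ae (heq.and hleQ) ha.1.le hlt hb.2.le
      have hl01 : l ∈ Ioo (0 : ℝ) 1 := ⟨ha.1.trans hl.1, hl.2.trans hb.2⟩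
      refine ⟨phi Q lam l, fun s => ?_, ?_, (hQ.lt_gam_iff hc hs hl01 b).1 hl.2⟩
      · rw [hQ.gam_phi hc hs hl01]
        have := h2 s
        linarith
      · rw [← hs.lt_iff_lt, hQ.cdf_phi hc hs hl01, ← hca]
        exact hQ.cdf_lt_cdf_left hl01 hl.1
    intro t
    have := hclosed.closure_eq ▸ hdense.closure_eq
    exact (this ▸ mem_univ t : t ∈ {t | ∀ s, Ψ t + gam Q lam t * (s - t) ≤ Ψ s})
  have hsub' : ∀ t s, Psi Q lam lam t + gam Q lam t * (s - t) ≤ Psi Q lam lam s := by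
    intro t s
    have := hQ.Gam_subgradient lam (hQ.gam_mem_and_cdf_gam hs t).1 s
    rw [hQ.phi_gam hs] at this
    unfold Psi
    linarith
  have hΨ : ∀ s, Ψ s = Psi Q lam lam s := by
    have hconst := eq_of_abs_sub_le_mul (hQ.continuous_gam hc hs)
      (abs_sub_sub_le_of_subgradient hsub hsub')
    intro s
    have h1 : ∫ x, (Ψ x - Psi Q lam lam x) ∂lam = 0 := by
      rw [integral_sub (integrable_of_lipschitzWith hp.lipschitz hlam)
        (integrable_of_lipschitzWith hpQ.lipschitz hlam), hp.integral_eq_zero,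
        hpQ.integral_eq_zero, sub_zero]
    simp_rw [fun x => hconst x s] at h1
    simp only [integral_const, probReal_univ, smul_eq_mul, one_mul] at h1
    linarith
  obtain ⟨hphi, hgam⟩ := phi_gam_map h hQ hμQ hc hs
  have hm : AEMeasurable (phi Q lam) μ := (hQ.aemeasurable_phi lam).mono_ac hμQ
  have hν : IsProbabilityMeasure (μ.map (phi Q lam)) := Measure.isProbabilityMeasure_map hm
  refine ⟨μ.map (phi Q lam), hν, ?_⟩
  have hPsi : Psi μ lam (μ.map (phi Q lam)) = Psi Q lam lam := by
    funext s
    simp only [Psi, Gam, hgam]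
  have hconj : conj μ lam (μ.map (phi Q lam)) =ᵐ[μ] G := by
    filter_upwards [h.ae_mem, hμQ.ae_le heq] with l hl hGl
    rw [conj, hphi l hl, hPsi, hGl, hΨ]
  rw [T_eq_map h hH, alpha_eq h hH,
    integral_congr_ae (hconj.mono fun l hl => by simp only [hl] :
      (fun l => deriv H (conj μ lam (μ.map (phi Q lam)) l)) =ᵐ[μ] fun l => deriv H (G l)),
    withDensity_congr_ae (hconj.mono fun l hl => by simp only [hl] :
      _ =ᵐ[μ] fun l => ENNReal.ofReal ((∫ x, deriv H (G x) ∂μ)⁻¹ * deriv H (G l)))]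
  change Q.map _ = lam
  rw [Measure.map_congr (hQ.ae_mem.mono hphi), hQ.map_phi lam]

end Existence

end

section

/-! ### The limit theorem -/

lemma isBase_withDensity {f : ℝ → ℝ} (hf : ContinuousOn f (Icc 0 1))
    (hfpos : ∀ x ∈ Icc (0 : ℝ) 1, 0 < f x) :
    IsBase ((volume.restrict (Icc (0 : ℝ) 1)).withDensity fun x => ENNReal.ofReal (f x)) := by
  refine ⟨withDensity_absolutelyContinuous _ _, withDensity_absolutelyContinuous'
    (hf.aemeasurable measurableSet_Icc).ennreal_ofReal ?_⟩
  filter_upwards [ae_restrict_mem measurableSet_Icc] with x hx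
  exact (ENNReal.ofReal_pos.2 (hfpos x hx)).ne'

lemma isRiskFun_of_strictConvexOn {H : ℝ → ℝ} (hH : ContDiff ℝ 2 H)
    (hconv : StrictConvexOn ℝ univ H) {ε K : ℝ} (hε : 0 < ε)
    (hbd : ∀ x, ε < deriv H x ∧ deriv H x < K) : IsRiskFun H ε K where
  differentiable := hH.differentiable two_ne_zero
  continuous_deriv := hH.continuous_deriv one_le_two
  strictMono_deriv := by
    rw [← strictMonoOn_univ]
    exact hconv.strictMonoOn_deriv fun x _ => hH.differentiable two_ne_zero x
  pos := hε
  le_deriv x := (hbd x).1.le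
  deriv_le x := (hbd x).2.le

variable {μ : Measure ℝ} [IsProbabilityMeasure μ] {H : ℝ → ℝ} {ε K : ℝ}

/-- Cost of the quantile coupling, an admissible plan. -/
lemma IsBase.W2_le (h : IsBase μ) (ν₁ ν₂ : Measure ℝ) [IsProbabilityMeasure ν₁]
    [IsProbabilityMeasure ν₂] :
    W2 ν₁ ν₂ ≤ (∫⁻ l, ENNReal.ofReal ((phi μ ν₁ l - phi μ ν₂ l) ^ 2) ∂μ) ^ (1 / 2 : ℝ) := by
  have h₁ := h.aemeasurable_phi ν₁
  have h₂ := h.aemeasurable_phi ν₂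
  refine ENNReal.rpow_le_rpow ?_ (by norm_num)
  refine (iInf₂_le (μ.map fun l => (phi μ ν₁ l, phi μ ν₂ l)) ⟨?_, ?_⟩).trans (le_of_eq ?_)
  · rw [lintegral_map' (f := fun p : ℝ × ℝ => ENNReal.ofReal ((p.1 - p.2) ^ 2)) (by fun_prop)
      (h₁.prodMk h₂)]
  · rw [AEMeasurable.map_map_of_aemeasurable measurable_fst.aemeasurable (h₁.prodMk h₂)]
    exact h.map_phi ν₁
  · rw [AEMeasurable.map_map_of_aemeasurable measurable_snd.aemeasurable (h₁.prodMk h₂)]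
    exact h.map_phi ν₂

lemma lintegral_pow_four_lt_top_of_fixedPoint (h : IsBase μ) (hH : IsRiskFun H ε K)
    {lam ν : Measure ℝ} [IsProbabilityMeasure ν] (hT : T μ H lam ν = lam)
    (hlam : ∫⁻ x, ENNReal.ofReal (x ^ 4) ∂lam < ∞) : ∫⁻ x, ENNReal.ofReal (x ^ 4) ∂ν < ∞ :=
  (lintegral_le_of_fixedPoint h hH hT (by fun_prop)).trans_lt
    (ENNReal.mul_lt_top ENNReal.ofReal_lt_top hlam)

/-- Stability for constant sequences: the L²(μ) distance of the two quantile maps is constant and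
tends to zero. -/
lemma fixedPoint_unique (h : IsBase μ) (hH : IsRiskFun H ε K) {lam ν ν' : Measure ℝ}
    [IsProbabilityMeasure lam] [IsProbabilityMeasure ν] [IsProbabilityMeasure ν']
    (hlam : ∫⁻ x, ENNReal.ofReal (x ^ 4) ∂lam < ∞) (hT : T μ H lam ν = lam)
    (hT' : T μ H lam ν' = lam) : ν' = ν := by
  have h1 := tendsto_lintegral_sq_of_fixedPoints h hH (lams := fun _ => lam) (νs := fun _ => ν')
    (fun _ => hT') hT hlam.ne (fun _ => le_rfl) le_rfl (ae_of_all _ fun _ => tendsto_const_nhds)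
  have h2 := tendsto_nhds_unique h1 tendsto_const_nhds
  have hm := (((h.aemeasurable_phi ν').sub (h.aemeasurable_phi ν)).pow_const 2).ennreal_ofReal
  have h3 := (lintegral_eq_zero_iff' hm).1 h2.symm
  have h4 : phi μ ν' =ᵐ[μ] phi μ ν := by
    filter_upwards [h3] with l hl
    have h5 : (phi μ ν' l - phi μ ν l) ^ 2 ≤ 0 := ENNReal.ofReal_eq_zero.1 hl
    exact sub_eq_zero.1 (pow_eq_zero_iff two_ne_zero |>.1 (le_antisymm h5 (sq_nonneg _)))
  calc ν' = μ.map (phi μ ν') := (h.map_phi ν').symm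
    _ = μ.map (phi μ ν) := Measure.map_congr h4
    _ = ν := h.map_phi ν

end

end RiskAverse

end

theorem mainTheorem7
    (μ : Measure ℝ) [IsProbabilityMeasure μ] (f : ℝ → ℝ)
    (hf : ContDiffOn ℝ 1 f (Icc 0 1)) (hfpos : ∀ x ∈ Icc (0 : ℝ) 1, 0 < f x)
    (hμ : μ = (volume.restrict (Icc (0 : ℝ) 1)).withDensity fun x => ENNReal.ofReal (f x))
    (H : ℝ → ℝ) (hH : ContDiff ℝ 2 H) (hconv : StrictConvexOn ℝ univ H)
    (hLip : ∃ C : ℝ≥0, LipschitzWith C (deriv H))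
    (hbd : ∃ ε K : ℝ, 0 < ε ∧ 0 < K ∧ ∀ x, ε < deriv H x ∧ deriv H x < K) :
    ∃ ν : ProbabilityMeasure ℝ,
      RiskAverse.T μ H (gaussianReal 0 1) ν = gaussianReal 0 1 ∧
      (∀ ν' : ProbabilityMeasure ℝ,
        RiskAverse.T μ H (gaussianReal 0 1) ν' = gaussianReal 0 1 → ν' = ν) ∧
      MemLp id 2 (ν : Measure ℝ) ∧
      ∀ νs : ℕ → ProbabilityMeasure ℝ,
        (∀ n : ℕ, 1 ≤ n →
          RiskAverse.T μ H (RiskAverse.lambdaBar n) (νs n) = RiskAverse.lambdaBar n) →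
        (∀ n : ℕ, 1 ≤ n → MemLp id 2 (νs n : Measure ℝ)) ∧
        Tendsto (fun n => RiskAverse.W2 (νs n) ν) atTop (𝓝 0) := by
  open RiskAverse in
  obtain ⟨ε, K, hε, -, hb⟩ := hbd
  have hR := isRiskFun_of_strictConvexOn hH hconv hε hb
  have h : IsBase μ := hμ ▸ isBase_withDensity hf.continuousOn hfpos
  have hg4 := lintegral_pow_four_gaussian_lt_top
  obtain ⟨ν, hν, hT⟩ := exists_fixedPoint h hR (integrable_of_fourth_moment hg4.ne)
    continuous_cdf_gaussian strictMono_cdf_gaussian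
  refine ⟨⟨ν, hν⟩, hT, fun ν' hT' => Subtype.ext
    (have := ν'.2; fixedPoint_unique (ν' := ν'.1) h hR hg4 hT hT'),
    memLp_two_of_fourth_moment (m := ν) (lintegral_pow_four_lt_top_of_fixedPoint h hR hT hg4).ne,
    fun νs hνs => ⟨fun n hn => memLp_two_of_fourth_moment
      (lintegral_pow_four_lt_top_of_fixedPoint h hR (hνs n hn)
        ((lintegral_pow_four_lambdaBar_le hn).trans_lt ENNReal.ofReal_lt_top)).ne, ?_⟩⟩
  -- Nothing is assumed about the measure of index 0.
  rw [← tendsto_add_atTop_iff_nat 1]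
  have key := tendsto_lintegral_sq_of_fixedPoints h hR (lams := fun n => lambdaBar (n + 1))
    (νs := fun n => (νs (n + 1) : Measure ℝ)) (fun n => hνs (n + 1) n.succ_pos) hT
    (C := max (ENNReal.ofReal (24 * (Real.exp (1 / 2) + Real.exp (1 / 2))))
      (∫⁻ x, ENNReal.ofReal (x ^ 4) ∂(gaussianReal 0 1)))
    (max_lt ENNReal.ofReal_lt_top hg4).ne
    (fun n => (lintegral_pow_four_lambdaBar_le n.succ_pos).trans (le_max_left _ _))
    (le_max_right _ _)
    (h.ae_mem.mono fun l hl => tendsto_rightInv strictMono_cdf_gaussian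
      (fun x => (tendsto_cdf_lambdaBar x).comp (tendsto_add_atTop_nat 1)) (h.cdf_mem hl))
  have key' := (ENNReal.continuous_rpow_const (y := 1 / 2)).tendsto 0 |>.comp key
  rw [ENNReal.zero_rpow_of_pos (by norm_num)] at key'
  exact tendsto_of_tendsto_of_tendsto_of_le_of_le tendsto_const_nhds key' (fun _ => zero_le)
    fun n => h.W2_le (νs (n + 1)) ν
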